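/- For a closed connected smooth Riemannian manifold $X$ of dimension $n>0$ with Laplace–Beltrami operator $\Delta_X\ge 0$, and $a\in C^\infty(X)$ real-valued, let $$\zeta_{X,a}(s)=\mathrm{tr}(a\,\Delta_X^{-s})=\sum_{k:\ \lambda_k\neq 0}\lambda_k^{-s}\int_X a\,\Psi_k^2\,d\mu_X ,\qquad \Re(s)>\tfrac n2,$$ continued meromorphically to $\mathbf C$, where $(\Psi_k)$ is any complete orthonormal system of $L^2(X,\mu_X)$ consisting of smooth real eigenfunctions, $\Delta_X\Psi_k=\lambda_k\Psi_k$. There exist non-isometric closed connected smooth Riemannian manifolds $X,Y$ and a smooth diffeomorphism $\varphi:X\to Y$ such that $\zeta_{Y,a}=\zeta_{X,a\circ\varphi}$ for all $a\in C^\infty(Y)$ (the series on both sides converging absolutely for $\Re(s)>n/2$). More precisely, let $$G_\pm=\frac1{2\sqrt3}\begin{pmatrix}\pm3&1&1&1\\-\sqrt7&\pm3\sqrt7&-\sqrt7&\sqrt7\\-\sqrt{13}&\sqrt{13}&\pm3\sqrt{13}&-\sqrt{13}\\-\sqrt{19}&-\sqrt{19}&\sqrt{19}&\pm3\sqrt{19}\end{pmatrix},$$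 let $\Lambda_\pm\subset\mathbf R^4$ be the lattice spanned by the columns of $G_\pm$, and let $\mathbf T_\pm=\mathbf R^4/\Lambda_\pm$ be the corresponding flat torus. Then complete orthonormal systems as above exist on $\mathbf T_\pm$; the tori $\mathbf T_-$ and $\mathbf T_+$ are isospectral (with multiplicities) but not isometric; the matrix $A=G_+G_-^{-1}$ has $\det A=1$; and the linear map $x\mapsto Ax$ of $\mathbf R^4$ induces a smooth diffeomorphism $\varphi:\mathbf T_-\to\mathbf T_+$ with $\zeta_{\mathbf T_+,a}=\zeta_{\mathbf T_-,a\circ\varphi}$ for all $a\in C^\infty(\mathbf T_+)$. -/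

import Mathlib

open Manifold
open scoped ContDiff MeasureTheory

noncomputable section

/-- A closed (compact, without boundary), connected, smooth Riemannian manifold of dimension `n`,
with smooth metric. -/
structure ClosedRiemannianManifold (n : ℕ) where
  carrier : Type
  [topology : TopologicalSpace carrier]
  [charts : ChartedSpace (EuclideanSpace ℝ (Fin n)) carrier]
  [smooth : IsManifold (𝓡 n) ∞ carrier]
  [hausdorff : T2Space carrier]
  [compact : CompactSpace carrier]
  [connected : ConnectedSpace carrier]
  metric : Bundle.ContMDiffRiemannianMetric (𝓡 n) ∞ (EuclideanSpace ℝ (Fin n))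
    (fun x : carrier => TangentSpace (𝓡 n) x)

namespace ClosedRiemannianManifold

variable {n : ℕ}

instance : CoeSort (ClosedRiemannianManifold n) Type := ⟨carrier⟩

attribute [instance] topology charts smooth hausdorff compact connected

instance (X : ClosedRiemannianManifold n) : MeasurableSpace X := borel X

instance (X : ClosedRiemannianManifold n) : BorelSpace X := ⟨rfl⟩

variable (X : ClosedRiemannianManifold n)

/-- The chart at `p`. -/
abbrev chart (p : X) : OpenPartialHomeomorph X (EuclideanSpace ℝ (Fin n)) :=
  chartAt (EuclideanSpace ℝ (Fin n)) p

/-- The coordinate vector field `∂/∂y_i` of the chart at `p`, at the point with coordinates `y`. -/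
def coordVector (p : X) (y : EuclideanSpace ℝ (Fin n)) (i : Fin n) :
    TangentSpace (𝓡 n) ((X.chart p).symm y) :=
  mfderiv (𝓡 n) (𝓡 n) (X.chart p).symm y (EuclideanSpace.single i (1 : ℝ))

/-- The matrix `(g_ij)` of the metric in the chart at `p`. -/
def metricMatrix (p : X) (y : EuclideanSpace ℝ (Fin n)) : Matrix (Fin n) (Fin n) ℝ :=
  Matrix.of fun i j =>
    X.metric.inner ((X.chart p).symm y) (X.coordVector p y i) (X.coordVector p y j)

/-- The volume density `√det (g_ij)` in the chart at `p`. -/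
def volumeDensity (p : X) (y : EuclideanSpace ℝ (Fin n)) : ℝ :=
  Real.sqrt (X.metricMatrix p y).det

/-- The Riemannian measure: the measures `√det (g_ij) dy` on the chart domains agree on overlaps,
and their supremum is the measure glued from them. -/
def vol : MeasureTheory.Measure X :=
  ⨆ p : X, MeasureTheory.Measure.map (X.chart p).symm
    ((MeasureTheory.volume.restrict (X.chart p).target).withDensity
      fun y => ENNReal.ofReal (X.volumeDensity p y))

/-- The Laplace-Beltrami operator, with nonnegative spectrum:
`Δ f = - (det g)^(-1/2) ∑ i, ∂_i ((det g)^(1/2) ∑ j, g^{ij} ∂_j f)`. -/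
def laplacian (f : X → ℝ) (x : X) : ℝ :=
  -((X.volumeDensity x (X.chart x x))⁻¹ *
    ∑ i, fderiv ℝ (fun y => X.volumeDensity x y *
        ∑ j, (X.metricMatrix x y)⁻¹ i j *
          fderiv ℝ (fun z => f ((X.chart x).symm z)) y (EuclideanSpace.single j (1 : ℝ)))
      (X.chart x x) (EuclideanSpace.single i (1 : ℝ)))

/-- A complete orthonormal system of `L²(X)` consisting of smooth real eigenfunctions of the
Laplace-Beltrami operator. For `n > 0` the space `L²(X)` is separable and infinite-dimensional, so
such a system is indexed by `ℕ`. -/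
structure EigenBasis where
  eigenvalue : ℕ → ℝ
  eigenfunction : ℕ → X → ℝ
  smooth : ∀ k, ContMDiff (𝓡 n) 𝓘(ℝ, ℝ) ∞ (eigenfunction k)
  laplacian_eq : ∀ k x, X.laplacian (eigenfunction k) x = eigenvalue k * eigenfunction k x
  orthonormal : ∀ j k, ∫ x, eigenfunction j x * eigenfunction k x ∂X.vol = if j = k then 1 else 0
  complete : ∀ f : X → ℝ, MeasureTheory.MemLp f 2 X.vol →
    (∀ k, ∫ x, f x * eigenfunction k x ∂X.vol = 0) → f =ᵐ[X.vol] 0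

variable {X} {Y : ClosedRiemannianManifold n}

/-- The `k`-th term `λ_k^(-s) ∫ a Ψ_k²` (over `λ_k ≠ 0`) of the Dirichlet series `tr(a Δ^(-s))`. -/
def EigenBasis.zetaTerm (B : X.EigenBasis) (a : X → ℝ) (s : ℂ) (k : ℕ) : ℂ :=
  if B.eigenvalue k = 0 then 0
  else (B.eigenvalue k : ℂ) ^ (-s) * ((∫ x, a x * B.eigenfunction k x ^ 2 ∂X.vol : ℝ) : ℂ)

open Classical in
/-- The meromorphic function on `ℂ` (in normal form) that equals `D` on `Re s > σ`; it is unique if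
it exists. If there is none, `D` on that half-plane, extended by zero. -/
def meromorphicExtension (σ : ℝ) (D : ℂ → ℂ) : ℂ → ℂ :=
  if h : ∃ F : ℂ → ℂ, MeromorphicNFOn F Set.univ ∧ ∀ s : ℂ, σ < s.re → F s = D s then h.choose
  else fun s => if σ < s.re then D s else 0

/-- The zeta function `ζ_{X,a}(s) = tr(a Δ^(-s))`: the Dirichlet series on `Re s > n / 2`, continued
meromorphically. -/
def EigenBasis.zeta (B : X.EigenBasis) (a : X → ℝ) : ℂ → ℂ :=
  meromorphicExtension ((n : ℝ) / 2) fun s => ∑' k, B.zetaTerm a s k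

/-- For every smooth real function `a` on `Y`, the Dirichlet series of `ζ_{Y,a}` and `ζ_{X,φ^* a}`
converge absolutely on `Re s > n / 2` and `ζ_{Y,a} = ζ_{X,φ^* a}`, for every choice of complete
orthonormal systems of eigenfunctions. -/
def ZetaPreserving (φ : X ≃ₘ⟮𝓡 n, 𝓡 n⟯ Y) : Prop :=
  ∀ (BX : X.EigenBasis) (BY : Y.EigenBasis) (a : Y → ℝ), ContMDiff (𝓡 n) 𝓘(ℝ, ℝ) ∞ a →
    (∀ s : ℂ, (n : ℝ) / 2 < s.re →
      Summable (BY.zetaTerm a s) ∧ Summable (BX.zetaTerm (a ∘ φ) s)) ∧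
    BY.zeta a = BX.zeta (a ∘ φ)

variable (X Y)

/-- The spectra agree with multiplicities. -/
def Isospectral : Prop :=
  ∀ (BX : X.EigenBasis) (BY : Y.EigenBasis),
    ∃ σ : Equiv.Perm ℕ, ∀ k, BY.eigenvalue (σ k) = BX.eigenvalue k

/-- There is a Riemannian isometry, i.e. a diffeomorphism that pulls back `g_Y` to `g_X`. -/
def Isometric : Prop :=
  ∃ ψ : X ≃ₘ⟮𝓡 n, 𝓡 n⟯ Y, ∀ (x : X) (v w : TangentSpace (𝓡 n) x),
    Y.metric.inner (ψ x) (mfderiv (𝓡 n) (𝓡 n) ψ x v) (mfderiv (𝓡 n) (𝓡 n) ψ x w) =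
      X.metric.inner x v w

end ClosedRiemannianManifold

/-! ### Flat tori -/

namespace FlatTorus
variable {n : ℕ}
def Carrier (L : Submodule ℤ (EuclideanSpace ℝ (Fin n))) : Type :=
  EuclideanSpace ℝ (Fin n) ⧸ L.toAddSubgroup

variable (L : Submodule ℤ (EuclideanSpace ℝ (Fin n)))

instance : TopologicalSpace (Carrier L) :=
  inferInstanceAs (TopologicalSpace (EuclideanSpace ℝ (Fin n) ⧸ L.toAddSubgroup))

def proj (x : EuclideanSpace ℝ (Fin n)) : Carrier L := QuotientAddGroup.mk x

theorem proj_surjective : Function.Surjective (proj L) := Quotient.mk_surjective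
theorem continuous_proj : Continuous (proj L) := continuous_quot_mk
theorem proj_eq_iff {x y : EuclideanSpace ℝ (Fin n)} : proj L x = proj L y ↔ y - x ∈ L :=
  QuotientAddGroup.eq.trans (by rw [neg_add_eq_sub]; rfl)

instance : ConnectedSpace (Carrier L) := (proj_surjective L).connectedSpace (continuous_proj L)

variable [DiscreteTopology L]

theorem isLocalHomeomorph_proj : IsLocalHomeomorph (proj L) := by
  have : IsDiscrete (L.toAddSubgroup : Set (EuclideanSpace ℝ (Fin n))) := ⟨‹DiscreteTopology L›⟩
  exact (L.toAddSubgroup.isAddQuotientCoveringMap_of_comm this).isCoveringMap.isLocalHomeomorph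

instance : T2Space (Carrier L) := by
  have : IsClosed (L.toAddSubgroup : Set (EuclideanSpace ℝ (Fin n))) := by
    have : DiscreteTopology L.toAddSubgroup := ‹DiscreteTopology L›
    exact AddSubgroup.isClosed_of_discrete
  have : T3Space (EuclideanSpace ℝ (Fin n) ⧸ L.toAddSubgroup) := inferInstance
  exact inferInstanceAs (T2Space (EuclideanSpace ℝ (Fin n) ⧸ L.toAddSubgroup))

/-- The atlas of all local inverses of the projection. -/
instance : ChartedSpace (EuclideanSpace ℝ (Fin n)) (Carrier L) where
  atlas := Set.range fun a => (isLocalHomeomorph_proj L).localInverseAt a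
  chartAt p := (isLocalHomeomorph_proj L).localInverseAt (Function.surjInv (proj_surjective L) p)
  mem_chart_source p := by
    nth_rw 2 [← Function.surjInv_eq (proj_surjective L) p]
    exact (isLocalHomeomorph_proj L).apply_self_mem_localInverseAt_source
  chart_mem_atlas p := ⟨_, rfl⟩

theorem chart_symm {e : OpenPartialHomeomorph (Carrier L) (EuclideanSpace ℝ (Fin n))}
    (he : e ∈ atlas (EuclideanSpace ℝ (Fin n)) (Carrier L)) : ⇑e.symm = proj L := by
  obtain ⟨a, rfl⟩ := he
  exact (isLocalHomeomorph_proj L).localInverseAt_symm a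

theorem proj_chart {e : OpenPartialHomeomorph (Carrier L) (EuclideanSpace ℝ (Fin n))}
    (he : e ∈ atlas (EuclideanSpace ℝ (Fin n)) (Carrier L)) {q : Carrier L} (hq : q ∈ e.source) :
    proj L (e q) = q := by
  rw [← chart_symm L he]; exact e.left_inv hq

/-- Near each point of its domain, a chart precomposed with the projection is a translation. -/
theorem chart_proj_eventuallyEq
    {e : OpenPartialHomeomorph (Carrier L) (EuclideanSpace ℝ (Fin n))}
    (he : e ∈ atlas (EuclideanSpace ℝ (Fin n)) (Carrier L)) {x : EuclideanSpace ℝ (Fin n)}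
    (hx : proj L x ∈ e.source) :
    (fun y => e (proj L y)) =ᶠ[nhds x] fun y => y + (e (proj L x) - x) := by
  have hL : IsDiscrete (L : Set (EuclideanSpace ℝ (Fin n))) := ⟨‹DiscreteTopology L›⟩
  have hmem : ∀ y, proj L y ∈ e.source → e (proj L y) - y ∈ L := fun y hy =>
    (proj_eq_iff L).1 (proj_chart L he hy).symm
  obtain ⟨U, hU, hUL⟩ : ∃ U ∈ nhds (0 : EuclideanSpace ℝ (Fin n)), ∀ z ∈ U, z ∈ L → z = 0 := by
    have h1 : {(0 : L)} ∈ nhds (0 : L) := (isOpen_discrete _).mem_nhds rfl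
    rw [nhds_subtype_eq_comap] at h1
    obtain ⟨U, hU, h2⟩ := Filter.mem_comap.1 h1
    exact ⟨U, hU, fun z hz hzL => congrArg Subtype.val (h2 (show (⟨z, hzL⟩ : L) ∈ _ from hz))⟩
  have hev : ∀ᶠ y in nhds x, proj L y ∈ e.source :=
    (continuous_proj L).continuousAt (e.open_source.mem_nhds hx)
  have hcont : Filter.Tendsto (fun y => (e (proj L y) - y) - (e (proj L x) - x)) (nhds x)
      (nhds 0) := by
    have : ContinuousAt (fun y => (e (proj L y) - y) - (e (proj L x) - x)) x :=
      (((e.continuousAt hx).comp (continuous_proj L).continuousAt).sub continuousAt_id).sub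
        continuousAt_const
    simpa [ContinuousAt] using this
  filter_upwards [hev, hcont hU] with y hy hyU
  have := hUL _ hyU (L.sub_mem (hmem y hy) (hmem x hx))
  rw [sub_eq_zero, sub_eq_iff_eq_add] at this
  rw [this, add_comm]

instance : IsManifold (𝓡 n) ∞ (Carrier L) := by
  refine isManifold_of_contDiffOn _ _ _ fun e e' he he' => ?_
  rintro y ⟨hy, -⟩
  have hy' : proj L y ∈ e'.source := by
    have h1 : e.symm y ∈ e'.source := hy.2
    rwa [chart_symm L he] at h1
  have h : ContDiffAt ℝ ∞ (fun z => e' (proj L z)) y :=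
    (contDiffAt_id.add contDiffAt_const).congr_of_eventuallyEq (chart_proj_eventuallyEq L he' hy')
  have h2 : ((𝓡 n) ∘ (e.symm ≫ₕ e') ∘ (𝓡 n).symm) = fun z => e' (proj L z) := by
    funext z
    simp [chart_symm L he]
  rw [h2]
  exact h.contDiffWithinAt

theorem tangentCoordChange_eq (p q z : Carrier L)
    (hz : z ∈ (chartAt (EuclideanSpace ℝ (Fin n)) p).source)
    (hz' : z ∈ (chartAt (EuclideanSpace ℝ (Fin n)) q).source) :
    tangentCoordChange (𝓡 n) p q z = ContinuousLinearMap.id ℝ (EuclideanSpace ℝ (Fin n)) := by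
  have hp := chart_mem_atlas (EuclideanSpace ℝ (Fin n)) p
  have hq := chart_mem_atlas (EuclideanSpace ℝ (Fin n)) q
  rw [tangentCoordChange_def]
  have h2 : (extChartAt (𝓡 n) q ∘ (extChartAt (𝓡 n) p).symm) =
      fun y => chartAt (EuclideanSpace ℝ (Fin n)) q (proj L y) := by
    funext y
    simp [extChartAt, chart_symm L hp]
  have h3 : extChartAt (𝓡 n) p z = chartAt (EuclideanSpace ℝ (Fin n)) p z := by simp [extChartAt]
  rw [h2, h3, (by simp : Set.range (𝓡 n) = Set.univ), fderivWithin_univ,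
    (chart_proj_eventuallyEq L hq (by rwa [proj_chart L hp hz])).fderiv_eq]
  rw [fderiv_add_const]
  exact fderiv_fun_id

/-- The Euclidean inner product as a continuous bilinear form. -/
def euclideanForm (n : ℕ) :
    EuclideanSpace ℝ (Fin n) →L[ℝ] EuclideanSpace ℝ (Fin n) →L[ℝ] ℝ := innerSL ℝ

/-- The flat metric: in every chart it is the Euclidean inner product. -/
def metric : Bundle.ContMDiffRiemannianMetric (𝓡 n) ∞ (EuclideanSpace ℝ (Fin n))
    (fun x : Carrier L => TangentSpace (𝓡 n) x) where
  inner _ := euclideanForm n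
  symm _ v w := real_inner_comm (F := EuclideanSpace ℝ (Fin n)) w v
  pos _ v hv := real_inner_self_pos (F := EuclideanSpace ℝ (Fin n)) |>.2 hv
  isVonNBounded _ := by
    change Bornology.IsVonNBounded ℝ {v : EuclideanSpace ℝ (Fin n) | inner ℝ v v < 1}
    refine (NormedSpace.isVonNBounded_ball ℝ (EuclideanSpace ℝ (Fin n)) 1).subset fun v hv => ?_
    have hv' : inner ℝ v v < 1 := hv
    rw [real_inner_self_eq_norm_sq] at hv'
    rw [mem_ball_zero_iff]
    nlinarith [norm_nonneg v]
  contMDiff := by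
    intro p
    refine (Bundle.contMDiffAt_section _).2 ?_
    refine (contMDiffAt_const (c := euclideanForm n)).congr_of_eventuallyEq ?_
    filter_upwards [(chartAt (EuclideanSpace ℝ (Fin n)) p).open_source.mem_nhds
      (mem_chart_source _ p)] with q hq
    ext v w
    have hq' : q ∈ (trivializationAt (EuclideanSpace ℝ (Fin n))
        (fun x : Carrier L => TangentSpace (𝓡 n) x) p).baseSet := hq
    have hs : ∀ u : EuclideanSpace ℝ (Fin n),
        (trivializationAt (EuclideanSpace ℝ (Fin n))
          (fun x : Carrier L => TangentSpace (𝓡 n) x) p).symm q u = u := by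
      intro u
      refine (Bundle.Trivialization.symmL_apply (R := ℝ) _ hq' u).symm.trans ?_
      refine (congrArg (fun T => T u) (TangentBundle.symmL_trivializationAt_eq_core (I := 𝓡 n) hq)).trans ?_
      exact congrArg (fun T => T u) (tangentCoordChange_eq L p q q hq (mem_chart_source _ q))
    refine (inCoordinates_apply_eq₂ hq' hq' (by simp)).trans ?_
    rw [hs, hs]
    simp
    rfl

instance [IsZLattice ℝ L] : CompactSpace (Carrier L) := by
  have := IsZLattice.isCompact_range_of_periodic L (proj L) (continuous_proj L) ?_
  · rw [(proj_surjective L).range_eq] at this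
    exact ⟨this⟩
  · intro z w hw
    rw [eq_comm, proj_eq_iff]; simpa
theorem contMDiff_proj : ContMDiff (𝓡 n) (𝓡 n) ∞ (proj L) := by
  intro x
  set e := (isLocalHomeomorph_proj L).localInverseAt x with he
  have hx : x ∈ e.target := (isLocalHomeomorph_proj L).self_mem_localInverseAt_target
  have ha : e ∈ IsManifold.maximalAtlas (𝓡 n) ∞ (Carrier L) :=
    IsManifold.subset_maximalAtlas ⟨x, rfl⟩
  have h := (contMDiffOn_symm_of_mem_maximalAtlas ha).contMDiffAt (e.open_target.mem_nhds hx)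
  rwa [chart_symm L ⟨x, rfl⟩] at h

/-- The projection from Euclidean space is a local isometry. -/
theorem metric_mfderiv_proj (x : EuclideanSpace ℝ (Fin n)) (v w : EuclideanSpace ℝ (Fin n)) :
    (metric L).inner (proj L x) (mfderiv (𝓡 n) (𝓡 n) (proj L) x v)
      (mfderiv (𝓡 n) (𝓡 n) (proj L) x w) = inner ℝ v w := by
  have hd : ∀ u : EuclideanSpace ℝ (Fin n), mfderiv (𝓡 n) (𝓡 n) (proj L) x u = u := by
    intro u
    rw [((contMDiff_proj L).mdifferentiableAt (by simp)).mfderiv]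
    have hx := mem_chart_source (EuclideanSpace ℝ (Fin n)) (proj L x)
    have h := (chart_proj_eventuallyEq L
      (chart_mem_atlas (EuclideanSpace ℝ (Fin n)) (proj L x)) hx).fderiv_eq (𝕜 := ℝ)
    rw [fderiv_add_const, fderiv_fun_id] at h
    simp only [mfld_simps, fderivWithin_univ]
    exact congrArg (fun T => T u) h
  refine (congrArg₂ (fun a b => euclideanForm n a b) (hd v) (hd w)).trans rfl

end FlatTorus

/-- The flat torus `ℝⁿ / L` of a lattice `L` as a closed Riemannian manifold. -/
def flatTorus {n : ℕ} (L : Submodule ℤ (EuclideanSpace ℝ (Fin n))) [DiscreteTopology L]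
    [IsZLattice ℝ L] : ClosedRiemannianManifold n where
  carrier := FlatTorus.Carrier L
  metric := FlatTorus.metric L

/-- The projection from Euclidean space to the flat torus. -/
def flatTorus.proj {n : ℕ} (L : Submodule ℤ (EuclideanSpace ℝ (Fin n))) [DiscreteTopology L]
    [IsZLattice ℝ L] (x : EuclideanSpace ℝ (Fin n)) : flatTorus L :=
  FlatTorus.proj L x

/-! ### The two lattices -/

/-- The vector formed by column `j` of `G`. -/
def columnVector {n : ℕ} (G : Matrix (Fin n) (Fin n) ℝ) (j : Fin n) : EuclideanSpace ℝ (Fin n) :=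
  WithLp.toLp 2 fun i => G i j

/-- The subgroup of `ℝⁿ` spanned by the columns of `G`. -/
def columnLattice {n : ℕ} (G : Matrix (Fin n) (Fin n) ℝ) :
    Submodule ℤ (EuclideanSpace ℝ (Fin n)) :=
  Submodule.span ℤ (Set.range (columnVector G))

theorem exists_basis_columnVector {n : ℕ} {G : Matrix (Fin n) (Fin n) ℝ} (hG : G.det ≠ 0) :
    ∃ b : Module.Basis (Fin n) ℝ (EuclideanSpace ℝ (Fin n)), ⇑b = columnVector G := by
  have hu : IsUnit G := (Matrix.isUnit_iff_isUnit_det G).2 (isUnit_iff_ne_zero.2 hG)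
  have h1 : LinearIndependent ℝ G.col := Matrix.linearIndependent_cols_iff_isUnit.2 hu
  have h2 : LinearIndependent ℝ (columnVector G) :=
    h1.map' (WithLp.linearEquiv 2 ℝ (Fin n → ℝ)).symm.toLinearMap (LinearEquiv.ker _)
  exact ⟨Module.Basis.mk h2 (h2.span_eq_top_of_card_eq_finrank' (by simp)).ge, by simp⟩

theorem discreteTopology_columnLattice {n : ℕ} {G : Matrix (Fin n) (Fin n) ℝ} (hG : G.det ≠ 0) :
    DiscreteTopology (columnLattice G) := by
  obtain ⟨b, hb⟩ := exists_basis_columnVector hG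
  rw [columnLattice, ← hb]
  infer_instance

theorem isZLattice_columnLattice {n : ℕ} {G : Matrix (Fin n) (Fin n) ℝ} (hG : G.det ≠ 0)
    [DiscreteTopology (columnLattice G)] :
    IsZLattice ℝ (columnLattice G) := by
  obtain ⟨b, hb⟩ := exists_basis_columnVector hG
  refine ⟨?_⟩
  rw [columnLattice, ← hb]
  exact ZSpan.span_top b

/-- The generator matrices `G₊` (`e = 1`) and `G₋` (`e = -1`). -/
def generatorMatrix (e : ℝ) : Matrix (Fin 4) (Fin 4) ℝ :=
  (1 / (2 * √3)) •
    !![ 3 * e,           1,            1,            1;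
         -√7, 3 * e * √7,          -√7,           √7;
        -√13,        √13,  3 * e * √13,         -√13;
        -√19,       -√19,          √19,  3 * e * √19]

theorem generatorMatrix_det_ne_zero (e : ℝ) : (generatorMatrix e).det ≠ 0 := by
  have h : (generatorMatrix e).det =
      (1 / (2 * √3)) ^ 4 * (√7 * √13 * √19 * (9 * e ^ 2 + 3) ^ 2) := by
    rw [generatorMatrix, Matrix.det_smul]
    simp [Matrix.det_succ_row_zero, Fin.sum_univ_succ, Fin.succAbove]
    ring
  rw [h]
  positivity

instance (e : ℝ) : DiscreteTopology (columnLattice (generatorMatrix e)) :=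
  discreteTopology_columnLattice (generatorMatrix_det_ne_zero e)

instance (e : ℝ) : IsZLattice ℝ (columnLattice (generatorMatrix e)) :=
  isZLattice_columnLattice (generatorMatrix_det_ne_zero e)

/-- The lattice `Λ₊` spanned by the columns of `G₊`. -/
abbrev latticePlus : Submodule ℤ (EuclideanSpace ℝ (Fin 4)) := columnLattice (generatorMatrix 1)

/-- The lattice `Λ₋` spanned by the columns of `G₋`. -/
abbrev latticeMinus : Submodule ℤ (EuclideanSpace ℝ (Fin 4)) := columnLattice (generatorMatrix (-1))

/-- The flat torus `T₊ = ℝ⁴ / Λ₊`. -/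
abbrev torusPlus : ClosedRiemannianManifold 4 := flatTorus latticePlus

/-- The flat torus `T₋ = ℝ⁴ / Λ₋`. -/
abbrev torusMinus : ClosedRiemannianManifold 4 := flatTorus latticeMinus

/-- The matrix `A = G₊ G₋⁻¹`, which maps `Λ₋` onto `Λ₊`. -/
def changeOfBasis : Matrix (Fin 4) (Fin 4) ℝ := generatorMatrix 1 * (generatorMatrix (-1))⁻¹

end

/-! On a flat torus `ℝⁿ / L` an eigenspace of the Laplacian is spanned by the waves `cos 2π⟨k,x⟩ +
sin 2π⟨k,x⟩`, with `k` in the dual lattice of a fixed length. The squares of the waves of `k` and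
`-k` add up to 2, so the squares of an orthonormal basis of an eigenspace sum to a constant. Hence
the trace of `a` on an eigenspace is its dimension times the mean of `a`, and `ζ_a` is the mean of
`a` times the Epstein zeta function of the dual lattice (`summable_zetaTerm_and_tsum_eq`). A linear
isomorphism of determinant 1 between isospectral flat tori preserves means, hence all these zeta
functions (`zetaPreserving_torusDiffeomorph`). The statement concerns arbitrary eigenbases, so the
explicit waves are compared with any other system: eigenfunctions of distinct eigenvalues are
orthogonal (`integral_laplacian_mul`), and Parseval's identity makes multiplicities and traces on
eigenspaces independent of the system.

For the two lattices, `G = (2√3)⁻¹ D H`, where `D = diag(1, √7, √13, √19)` and `H` is an integer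
matrix with `H Hᵀ = 12`. The dual lattice is therefore `H ℤ⁴` with rescaled coordinates. Changing
the sign of one suitable coordinate carries `H₋ ℤ⁴` bijectively to `H₊ ℤ⁴` (`tetraFlip_mem`) and
preserves every diagonal quadratic form, so the tori are isospectral.

An isometry of flat tori lifts to an isometry of `ℝ⁴`, which is affine, and its linear part maps
`Λ₋` into `Λ₊`. The first two columns of `G₋` have squared norms 4 and 8 and inner product 2. In
`Λ₊` only one vector, up to sign, has squared norm 4, and no vector of squared norm 8 has inner
product ±2 with it (`short_vectors`, `second_vectors`). -/

noncomputable section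

namespace FlatTorus

/-! ### Flat tori seen through the projection from Euclidean space -/

section Geometry

variable {n : ℕ}

/-- The Euclidean Laplacian with nonnegative spectrum. -/
def euclideanLaplacian (F : EuclideanSpace ℝ (Fin n) → ℝ) (x : EuclideanSpace ℝ (Fin n)) : ℝ :=
  -∑ i, fderiv ℝ (fun y => fderiv ℝ F y (EuclideanSpace.single i (1 : ℝ))) x
    (EuclideanSpace.single i (1 : ℝ))

theorem euclideanLaplacian_add_period {F : EuclideanSpace ℝ (Fin n) → ℝ}
    {l : EuclideanSpace ℝ (Fin n)} (hF : ∀ x, F (x + l) = F x) (x : EuclideanSpace ℝ (Fin n)) :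
    euclideanLaplacian F (x + l) = euclideanLaplacian F x := by
  have hF' : (fun x => F (x + l)) = F := funext hF
  have h1 : ∀ y, fderiv ℝ F (y + l) = fderiv ℝ F y := fun y => by
    rw [← fderiv_comp_add_right, hF']
  simp only [euclideanLaplacian]
  congr 1
  refine Finset.sum_congr rfl fun i _ => ?_
  rw [← fderiv_comp_add_right]
  simp only [h1]

variable (L : Submodule ℤ (EuclideanSpace ℝ (Fin n))) [DiscreteTopology L]

theorem mfderiv_proj_apply (x u : EuclideanSpace ℝ (Fin n)) :
    mfderiv (𝓡 n) (𝓡 n) (proj L) x u = u := by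
  rw [((contMDiff_proj L).mdifferentiableAt (by simp)).mfderiv]
  have hx := mem_chart_source (EuclideanSpace ℝ (Fin n)) (proj L x)
  have h := (chart_proj_eventuallyEq L
    (chart_mem_atlas (EuclideanSpace ℝ (Fin n)) (proj L x)) hx).fderiv_eq (𝕜 := ℝ)
  rw [fderiv_add_const, fderiv_fun_id] at h
  simp only [mfld_simps, fderivWithin_univ]
  exact congrArg (fun T => T u) h

variable [IsZLattice ℝ L]

theorem flatTorus_chart_symm (p : flatTorus L) :
    ⇑((flatTorus L).chart p).symm = flatTorus.proj L :=
  chart_symm L (chart_mem_atlas (EuclideanSpace ℝ (Fin n)) (p : Carrier L))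

theorem flatTorus_metricMatrix (p : flatTorus L) (y : EuclideanSpace ℝ (Fin n)) :
    (flatTorus L).metricMatrix p y = 1 := by
  have key : ∀ e : EuclideanSpace ℝ (Fin n) → Carrier L, e = proj L →
      ∀ u : EuclideanSpace ℝ (Fin n),
      mfderiv (𝓡 n) (𝓡 n) e y u = u := by
    rintro _ rfl u
    exact mfderiv_proj_apply L y u
  have hk := key _ (flatTorus_chart_symm L p)
  ext i j
  have h : (flatTorus L).metricMatrix p y i j = inner ℝ
      (EuclideanSpace.single i (1 : ℝ)) (EuclideanSpace.single j (1 : ℝ)) :=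
    congrArg₂ (fun a b => euclideanForm n a b) (hk (EuclideanSpace.single i (1 : ℝ)))
      (hk (EuclideanSpace.single j (1 : ℝ)))
  rw [h]
  simp [Matrix.one_apply, EuclideanSpace.inner_single_left]

theorem flatTorus_volumeDensity (p : flatTorus L) (y : EuclideanSpace ℝ (Fin n)) :
    (flatTorus L).volumeDensity p y = 1 := by
  rw [ClosedRiemannianManifold.volumeDensity, flatTorus_metricMatrix]
  simp

theorem flatTorus_proj_eq_iff {x y : EuclideanSpace ℝ (Fin n)} :
    flatTorus.proj L x = flatTorus.proj L y ↔ y - x ∈ L :=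
  proj_eq_iff L

theorem flatTorus_proj_surjective : Function.Surjective (flatTorus.proj L) :=
  proj_surjective L

theorem continuous_flatTorus_proj : Continuous (flatTorus.proj L) :=
  continuous_proj L

theorem contMDiff_flatTorus_proj : ContMDiff (𝓡 n) (𝓡 n) ∞ (flatTorus.proj L) :=
  contMDiff_proj L

theorem flatTorus_proj_add {l : EuclideanSpace ℝ (Fin n)} (hl : l ∈ L)
    (x : EuclideanSpace ℝ (Fin n)) : flatTorus.proj L (x + l) = flatTorus.proj L x :=
  ((flatTorus_proj_eq_iff L).2 (by simpa using hl)).symm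

/-- The metric matrix is the identity in every chart, so the chart formula becomes the Euclidean
Laplacian at the lift picked by the chart. That lift differs from `x` by a lattice vector, and
periodicity removes the difference. -/
theorem flatTorus_laplacian_proj (f : flatTorus L → ℝ) (x : EuclideanSpace ℝ (Fin n)) :
    (flatTorus L).laplacian f (flatTorus.proj L x) =
      euclideanLaplacian (fun y => f (flatTorus.proj L y)) x := by
  set p := flatTorus.proj L x
  have h1 : (flatTorus L).laplacian f p =
      euclideanLaplacian (fun y => f (flatTorus.proj L y)) ((flatTorus L).chart p p) := by
    simp only [ClosedRiemannianManifold.laplacian, flatTorus_volumeDensity, flatTorus_metricMatrix,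
      flatTorus_chart_symm, euclideanLaplacian]
    simp [Matrix.one_apply]
  have h2 : flatTorus.proj L ((flatTorus L).chart p p) = flatTorus.proj L x :=
    proj_chart L (chart_mem_atlas (EuclideanSpace ℝ (Fin n)) (p : Carrier L))
      (mem_chart_source (EuclideanSpace ℝ (Fin n)) (p : Carrier L))
  have h3 := (flatTorus_proj_eq_iff L).1 h2
  rw [h1, ← euclideanLaplacian_add_period (l := x - (flatTorus L).chart p p)
    (fun y => congrArg f (flatTorus_proj_add L h3 y))]
  simp

/-- Charts are local inverses of the projection, so near `p` the map `g` is its pullback to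
Euclidean space composed with a chart. -/
theorem contMDiff_of_contMDiff_comp_proj {E H M : Type*} [NormedAddCommGroup E]
    [NormedSpace ℝ E] [TopologicalSpace H] {I : ModelWithCorners ℝ E H} [TopologicalSpace M]
    [ChartedSpace H M] {g : flatTorus L → M}
    (hg : ContMDiff (𝓡 n) I ∞ fun x => g (flatTorus.proj L x)) :
    ContMDiff (𝓡 n) I ∞ g := by
  intro p
  have h1 : ContMDiffAt (𝓡 n) (𝓡 n) ∞ ((flatTorus L).chart p) p :=
    contMDiffOn_chart.contMDiffAt
      (((flatTorus L).chart p).open_source.mem_nhds (mem_chart_source _ p))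
  refine (ContMDiffAt.comp p hg.contMDiffAt h1).congr_of_eventuallyEq ?_
  filter_upwards [((flatTorus L).chart p).open_source.mem_nhds (mem_chart_source _ p)] with q hq
  exact congrArg g (proj_chart L (chart_mem_atlas (EuclideanSpace ℝ (Fin n)) (p : Carrier L)) hq).symm

theorem contMDiff_real_of_contDiff_comp_proj {g : flatTorus L → ℝ}
    (hg : ContDiff ℝ ∞ fun x => g (flatTorus.proj L x)) :
    ContMDiff (𝓡 n) 𝓘(ℝ, ℝ) ∞ g :=
  contMDiff_of_contMDiff_comp_proj L hg.contMDiff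

theorem contDiff_comp_proj {g : flatTorus L → ℝ} (hg : ContMDiff (𝓡 n) 𝓘(ℝ, ℝ) ∞ g) :
    ContDiff ℝ ∞ fun x => g (flatTorus.proj L x) :=
  contMDiff_iff_contDiff.1 (hg.comp (contMDiff_flatTorus_proj L))

end Geometry

/-! ### The Riemannian measure and fundamental domains -/

section Measure

open MeasureTheory
open scoped Pointwise

variable {n : ℕ} (L : Submodule ℤ (EuclideanSpace ℝ (Fin n))) [DiscreteTopology L]
  [IsZLattice ℝ L]

/-- A lattice-invariant set has the same measure in any two fundamental domains. Working over `U`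
admits chart targets, which are fundamental domains only over the source of their chart. -/
theorem map_restrict_proj_eq_of_isAddFundamentalDomain {F T U : Set (EuclideanSpace ℝ (Fin n))}
    {S : Set (flatTorus L)} (hF : IsAddFundamentalDomain L F (volume.restrict U))
    (hT : IsAddFundamentalDomain L T (volume.restrict U)) (hU : U = flatTorus.proj L ⁻¹' S)
    (hS : MeasurableSet S) (hTU : T ⊆ U) :
    Measure.map (flatTorus.proj L) (volume.restrict T) =
      (Measure.map (flatTorus.proj L) (volume.restrict F)).restrict S := by
  have hm : Measurable (flatTorus.proj L) := (continuous_flatTorus_proj L).measurable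
  have hUm : MeasurableSet U := hU ▸ hm hS
  have hinv : ∀ (A : Set (flatTorus L)) (g : L),
      (fun x => g +ᵥ x) ⁻¹' (flatTorus.proj L ⁻¹' A) = flatTorus.proj L ⁻¹' A := fun A g => by
    ext x
    have : flatTorus.proj L (g +ᵥ x) = flatTorus.proj L x := by
      rw [Submodule.vadd_def, vadd_eq_add, add_comm]
      exact flatTorus_proj_add L g.2 x
    simp [this]
  have : VAddInvariantMeasure L (EuclideanSpace ℝ (Fin n)) volume :=
    inferInstanceAs <| VAddInvariantMeasure L.toAddSubgroup (EuclideanSpace ℝ (Fin n)) volume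
  have : VAddInvariantMeasure L (EuclideanSpace ℝ (Fin n)) (volume.restrict U) := ⟨fun g s hs => by
    have hg : Measurable fun x : EuclideanSpace ℝ (Fin n) => g +ᵥ x :=
      measurable_const_add (g : EuclideanSpace ℝ (Fin n))
    rw [Measure.restrict_apply (hg hs), Measure.restrict_apply hs, hU]
    nth_rw 1 [← hinv S g]
    rw [← Set.preimage_inter, measure_preimage_vadd]⟩
  ext A hA
  have h := hT.measure_set_eq hF (hm hA) (hinv A)
  rw [Measure.restrict_apply' hUm, Measure.restrict_apply' hUm] at h
  rw [Measure.map_apply hm hA, Measure.restrict_apply (hm hA), Measure.restrict_apply hA,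
    Measure.map_apply hm (hA.inter hS), Measure.restrict_apply (hm (hA.inter hS)),
    Set.preimage_inter, ← hU]
  rw [show flatTorus.proj L ⁻¹' A ∩ U ∩ F = flatTorus.proj L ⁻¹' A ∩ F ∩ U by
    rw [Set.inter_right_comm], ← h, Set.inter_assoc, Set.inter_eq_left.2 hTU]

/-- The chart itself provides the lattice translation into the target, and the translates are
disjoint because the projection is injective on the target. -/
theorem isAddFundamentalDomain_chart_target (p : flatTorus L) :
    IsAddFundamentalDomain L ((flatTorus L).chart p).target
      (volume.restrict (flatTorus.proj L ⁻¹' ((flatTorus L).chart p).source)) := by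
  set e := (flatTorus L).chart p
  have hsymm : ⇑e.symm = flatTorus.proj L := flatTorus_chart_symm L p
  have hm : Measurable (flatTorus.proj L) := (continuous_flatTorus_proj L).measurable
  refine ⟨e.open_target.measurableSet.nullMeasurableSet, ?_, ?_⟩
  · refine (ae_restrict_iff' (hm e.open_source.measurableSet)).2 (Filter.Eventually.of_forall ?_)
    intro x hx
    have h1 : flatTorus.proj L x = flatTorus.proj L (e (flatTorus.proj L x)) := by
      rw [← hsymm, e.left_inv]
      rwa [hsymm]
    refine ⟨⟨_, (flatTorus_proj_eq_iff L).1 h1⟩, ?_⟩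
    rw [Submodule.vadd_def, vadd_eq_add, sub_add_cancel]
    exact e.map_source hx
  · intro a b hab
    refine Disjoint.aedisjoint (Set.disjoint_left.2 ?_)
    rintro _ ⟨x, hx, rfl⟩ ⟨y, hy, hxy⟩
    have hxy' : (b : EuclideanSpace ℝ (Fin n)) + y = a + x := hxy
    have h2 : flatTorus.proj L x = flatTorus.proj L y := by
      refine (flatTorus_proj_eq_iff L).2 ?_
      rw [show y - x = (a : EuclideanSpace ℝ (Fin n)) - b by
        rw [sub_eq_sub_iff_add_eq_add, add_comm, hxy']]
      exact L.sub_mem a.2 b.2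
    have h3 : x = y := by
      rw [← hsymm] at h2
      exact e.symm.injOn hx hy h2
    subst h3
    exact hab (Subtype.ext (add_right_cancel hxy').symm)

/-- The Riemannian measure of a flat torus is the image of Lebesgue measure on any fundamental
domain. -/
theorem flatTorus_vol_eq {F : Set (EuclideanSpace ℝ (Fin n))}
    (hF : IsAddFundamentalDomain L F volume) :
    (flatTorus L).vol = Measure.map (flatTorus.proj L) (volume.restrict F) := by
  set μ := Measure.map (flatTorus.proj L) (volume.restrict F)
  have hvol : (flatTorus L).vol =
      ⨆ p : flatTorus L, μ.restrict ((flatTorus L).chart p).source := by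
    refine iSup_congr fun p => ?_
    have h1 : (fun y => ENNReal.ofReal ((flatTorus L).volumeDensity p y)) = 1 := by
      funext y
      simp [flatTorus_volumeDensity]
    rw [h1, withDensity_one, flatTorus_chart_symm]
    refine map_restrict_proj_eq_of_isAddFundamentalDomain L
      (hF.mono Measure.restrict_le_self.absolutelyContinuous)
      (isAddFundamentalDomain_chart_target L p) rfl ((flatTorus L).chart p).open_source.measurableSet
      fun x hx => ?_
    have := ((flatTorus L).chart p).map_target hx
    rwa [flatTorus_chart_symm] at this
  have hle : (flatTorus L).vol ≤ μ := hvol ▸ iSup_le fun p => Measure.restrict_le_self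
  -- Two measures that agree on each member of a finite measurable cover are equal; compactness
  -- makes the cover by chart sources finite.
  obtain ⟨t, ht⟩ := isCompact_univ.elim_finite_subcover
    (fun p : flatTorus L => ((flatTorus L).chart p).source)
    (fun p => ((flatTorus L).chart p).open_source)
    (fun p _ => Set.mem_iUnion.2 ⟨p, mem_chart_source _ p⟩)
  have key : (flatTorus L).vol.restrict (⋃ p ∈ t, ((flatTorus L).chart p).source) =
      μ.restrict (⋃ p ∈ t, ((flatTorus L).chart p).source) := by
    refine Measure.restrict_biUnion_finset_congr.2 fun p _ =>
      le_antisymm (Measure.restrict_mono le_rfl hle) ?_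
    calc μ.restrict ((flatTorus L).chart p).source
        = (μ.restrict ((flatTorus L).chart p).source).restrict ((flatTorus L).chart p).source := by
          rw [Measure.restrict_restrict ((flatTorus L).chart p).open_source.measurableSet,
            Set.inter_self]
      _ ≤ _ := Measure.restrict_mono le_rfl (hvol ▸ le_iSup
          (fun p : flatTorus L => μ.restrict ((flatTorus L).chart p).source) p)
  rwa [Set.univ_subset_iff.1 ht, Measure.restrict_univ, Measure.restrict_univ] at key

theorem exists_isBounded_isAddFundamentalDomain : ∃ F : Set (EuclideanSpace ℝ (Fin n)),
    IsAddFundamentalDomain L F volume ∧ Bornology.IsBounded F :=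
  ⟨_, ZLattice.isAddFundamentalDomain (Module.Free.chooseBasis ℤ L) volume,
    ZSpan.fundamentalDomain_isBounded _⟩

instance : IsFiniteMeasure (flatTorus L).vol := by
  obtain ⟨F, hF, hb⟩ := exists_isBounded_isAddFundamentalDomain L
  rw [flatTorus_vol_eq L hF]
  have : IsFiniteMeasure ((volume : Measure (EuclideanSpace ℝ (Fin n))).restrict F) :=
    ⟨by simpa using hb.measure_lt_top⟩
  infer_instance

theorem flatTorus_vol_ne_zero : (flatTorus L).vol ≠ 0 := by
  obtain ⟨F, hF, -⟩ := exists_isBounded_isAddFundamentalDomain L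
  have : VAddInvariantMeasure L (EuclideanSpace ℝ (Fin n)) volume :=
    inferInstanceAs <| VAddInvariantMeasure L.toAddSubgroup (EuclideanSpace ℝ (Fin n)) volume
  rw [flatTorus_vol_eq L hF, Measure.map_ne_zero_iff
    (continuous_flatTorus_proj L).measurable.aemeasurable]
  simpa using hF.measure_ne_zero (NeZero.ne _)

theorem integral_flatTorus {F : Set (EuclideanSpace ℝ (Fin n))}
    (hF : IsAddFundamentalDomain L F volume) {g : flatTorus L → ℝ} (hg : Continuous g) :
    ∫ x, g x ∂(flatTorus L).vol = ∫ y in F, g (flatTorus.proj L y) := by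
  rw [flatTorus_vol_eq L hF]
  exact integral_map (continuous_flatTorus_proj L).measurable.aemeasurable
    hg.aestronglyMeasurable

/-- The translate `F + t` is again a fundamental domain, for every `t` and not only for lattice
vectors. -/
theorem setIntegral_comp_add_right {F : Set (EuclideanSpace ℝ (Fin n))}
    (hF : IsAddFundamentalDomain L F volume) {G : EuclideanSpace ℝ (Fin n) → ℝ}
    (hG : ∀ l ∈ L, ∀ x, G (x + l) = G x) (t : EuclideanSpace ℝ (Fin n)) :
    ∫ y in F, G (y + t) = ∫ y in F, G y := by
  have : VAddInvariantMeasure L (EuclideanSpace ℝ (Fin n)) volume :=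
    inferInstanceAs <| VAddInvariantMeasure L.toAddSubgroup (EuclideanSpace ℝ (Fin n)) volume
  have : VAddCommClass (EuclideanSpace ℝ (Fin n)) L (EuclideanSpace ℝ (Fin n)) :=
    inferInstanceAs <| VAddCommClass (EuclideanSpace ℝ (Fin n)) L.toAddSubgroup
      (EuclideanSpace ℝ (Fin n))
  have ht := hF.vadd_of_comm t
  have h1 := hF.setIntegral_eq ht (f := G) fun g x => by
    rw [Submodule.vadd_def, vadd_eq_add, add_comm]
    exact hG g g.2 x
  have h2 := (measurePreserving_add_right (volume : Measure (EuclideanSpace ℝ (Fin n))) t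
    ).setIntegral_image_emb (measurableEmbedding_addRight t) G F
  have h3 : (fun x => x + t) '' F = t +ᵥ F := by
    ext x
    simp [Set.mem_vadd_set_iff_neg_vadd_mem, add_comm]
  rw [h1, ← h3, h2]

end Measure

/-! ### Green's formula and symmetry of the Laplacian -/

section Stokes

open MeasureTheory

variable {n : ℕ} (L : Submodule ℤ (EuclideanSpace ℝ (Fin n))) [DiscreteTopology L]
  [IsZLattice ℝ L]

/-- The function `t ↦ ∫_F H (y + t v)` is constant by translation invariance. Its derivative at `0`,
taken under the integral sign, is the integral in question, so no boundary terms have to be handled.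
-/
theorem setIntegral_fderiv_eq_zero {F : Set (EuclideanSpace ℝ (Fin n))}
    (hF : IsAddFundamentalDomain L F volume) (hb : Bornology.IsBounded F)
    {H : EuclideanSpace ℝ (Fin n) → ℝ} (hH : ContDiff ℝ 1 H)
    (hper : ∀ l ∈ L, ∀ x, H (x + l) = H x) (v : EuclideanSpace ℝ (Fin n)) :
    ∫ y in F, fderiv ℝ H y v = 0 := by
  have hconst : ∀ t : ℝ, ∫ y in F, H (y + t • v) = ∫ y in F, H y := fun t =>
    setIntegral_comp_add_right L hF hper (t • v)
  obtain ⟨R, hR⟩ := hb.subset_closedBall 0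
  have hcont : Continuous fun y => fderiv ℝ H y v :=
    (hH.continuous_fderiv (by simp)).clm_apply continuous_const
  -- The ball of radius `R + ‖v‖` contains `y + t • v` for all `y ∈ F` and `|t| < 1`, so `C`
  -- dominates the derivative there.
  obtain ⟨C, hC⟩ := (isCompact_closedBall (0 : EuclideanSpace ℝ (Fin n)) (R + ‖v‖)
    ).exists_bound_of_continuousOn hcont.continuousOn
  have : IsFiniteMeasure ((volume : Measure (EuclideanSpace ℝ (Fin n))).restrict F) :=
    ⟨by simpa using hb.measure_lt_top⟩
  obtain ⟨D, hD⟩ := (isCompact_closedBall (0 : EuclideanSpace ℝ (Fin n)) R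
    ).exists_bound_of_continuousOn hH.continuous.continuousOn
  have hmem : ∀ᵐ y ∂(volume.restrict F), y ∈ F := ae_restrict_mem₀ hF.nullMeasurableSet
  have key := hasDerivAt_integral_of_dominated_loc_of_deriv_le (μ := volume.restrict F)
    (F := fun (t : ℝ) y => H (y + t • v)) (F' := fun t y => fderiv ℝ H (y + t • v) v)
    (bound := fun _ => C) (x₀ := (0 : ℝ)) (Metric.ball_mem_nhds 0 one_pos)
    (Filter.Eventually.of_forall fun t =>
      (hH.continuous.comp (continuous_id.add continuous_const)).aestronglyMeasurable)
    (Integrable.of_bound (by simpa using hH.continuous.aestronglyMeasurable) D (by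
      filter_upwards [hmem] with y hy
      simpa using hD y (hR hy)))
    (by simpa using hcont.aestronglyMeasurable)
    (by
      filter_upwards [hmem] with y hy t ht
      refine hC _ ?_
      have h1 : ‖y‖ ≤ R := by simpa using hR hy
      have h2 : |t| < 1 := by simpa using ht
      rw [mem_closedBall_zero_iff]
      refine (norm_add_le _ _).trans (add_le_add h1 ?_)
      rw [norm_smul, Real.norm_eq_abs]
      nlinarith [norm_nonneg v])
    (integrable_const C)
    (by
      refine Filter.Eventually.of_forall fun y t _ => ?_
      have h1 : HasDerivAt (fun t : ℝ => y + t • v) v t := by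
        simpa using ((hasDerivAt_id t).smul_const v).const_add y
      exact ((hH.differentiable (by simp) _).hasFDerivAt).comp_hasDerivAt t h1)
  have h2 := key.2
  simp only [hconst, zero_smul, add_zero] at h2
  exact h2.unique (hasDerivAt_const _ _)

/-- The integrand is the divergence of the periodic field `f ∇g - g ∇f`. -/
theorem setIntegral_euclideanLaplacian_mul {F : Set (EuclideanSpace ℝ (Fin n))}
    (hF : IsAddFundamentalDomain L F volume) (hb : Bornology.IsBounded F)
    {f g : EuclideanSpace ℝ (Fin n) → ℝ} (hf : ContDiff ℝ ∞ f) (hg : ContDiff ℝ ∞ g)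
    (hfp : ∀ l ∈ L, ∀ x, f (x + l) = f x) (hgp : ∀ l ∈ L, ∀ x, g (x + l) = g x) :
    ∫ y in F, (euclideanLaplacian f y * g y - f y * euclideanLaplacian g y) = 0 := by
  have hd : ∀ {h : EuclideanSpace ℝ (Fin n) → ℝ} (v : EuclideanSpace ℝ (Fin n)),
      ContDiff ℝ ∞ h → ContDiff ℝ ∞ fun y => fderiv ℝ h y v := fun v hh =>
    (hh.fderiv_right (m := ∞) (by simp)).clm_apply contDiff_const
  have hper : ∀ {h : EuclideanSpace ℝ (Fin n) → ℝ} (v : EuclideanSpace ℝ (Fin n)),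
      (∀ l ∈ L, ∀ x, h (x + l) = h x) → ∀ l ∈ L, ∀ x, fderiv ℝ h (x + l) v = fderiv ℝ h x v := by
    intro h v hp l hl x
    rw [← fderiv_comp_add_right, funext (hp l hl)]
  let W : Fin n → EuclideanSpace ℝ (Fin n) → ℝ := fun i y =>
    f y * fderiv ℝ g y (EuclideanSpace.single i 1) - fderiv ℝ f y (EuclideanSpace.single i 1) * g y
  have hW : ∀ i, ContDiff ℝ ∞ (W i) := fun i => (hf.mul (hd _ hg)).sub ((hd _ hf).mul hg)
  have hsum : ∀ y, euclideanLaplacian f y * g y - f y * euclideanLaplacian g y =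
      ∑ i, fderiv ℝ (W i) y (EuclideanSpace.single i 1) := by
    intro y
    simp only [euclideanLaplacian, neg_mul, mul_neg, sub_neg_eq_add, Finset.sum_mul, Finset.mul_sum]
    rw [← Finset.sum_neg_distrib, ← Finset.sum_add_distrib]
    refine Finset.sum_congr rfl fun i _ => ?_
    have d1 : ∀ {h : EuclideanSpace ℝ (Fin n) → ℝ}, ContDiff ℝ ∞ h → DifferentiableAt ℝ h y :=
      fun hh => hh.differentiable (by simp) y
    have hWd : HasFDerivAt (W i) _ y :=
      ((d1 hf).hasFDerivAt.mul (d1 (hd (EuclideanSpace.single i 1) hg)).hasFDerivAt).sub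
        ((d1 (hd (EuclideanSpace.single i 1) hf)).hasFDerivAt.mul (d1 hg).hasFDerivAt)
    rw [hWd.fderiv]
    simp
    ring
  simp only [hsum]
  have : IsFiniteMeasure ((volume : Measure (EuclideanSpace ℝ (Fin n))).restrict F) :=
    ⟨by simpa using hb.measure_lt_top⟩
  rw [integral_finsetSum]
  · refine Finset.sum_eq_zero fun i _ => setIntegral_fderiv_eq_zero L hF hb
      ((hW i).of_le (by simp)) (fun l hl x => ?_) _
    simp only [W, hper _ hfp l hl, hper _ hgp l hl, hfp l hl, hgp l hl]
  · intro i _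
    obtain ⟨R, hR⟩ := hb.subset_closedBall 0
    exact ((hd (EuclideanSpace.single i 1) (hW i)).continuous.continuousOn.integrableOn_compact
      (isCompact_closedBall _ _)).mono_set hR

/-- The Laplacian of a flat torus is symmetric. -/
theorem integral_laplacian_mul {f g : flatTorus L → ℝ} (hf : ContMDiff (𝓡 n) 𝓘(ℝ, ℝ) ∞ f)
    (hg : ContMDiff (𝓡 n) 𝓘(ℝ, ℝ) ∞ g) {c d : ℝ} (hfc : ∀ x, (flatTorus L).laplacian f x = c * f x)
    (hgd : ∀ x, (flatTorus L).laplacian g x = d * g x) (hcd : c ≠ d) :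
    ∫ x, f x * g x ∂(flatTorus L).vol = 0 := by
  obtain ⟨F, hF, hb⟩ := exists_isBounded_isAddFundamentalDomain L
  have h := setIntegral_euclideanLaplacian_mul L hF hb (contDiff_comp_proj L hf)
    (contDiff_comp_proj L hg) (fun l hl x => congrArg f (flatTorus_proj_add L hl x))
    (fun l hl x => congrArg g (flatTorus_proj_add L hl x))
  rw [integral_flatTorus L hF (g := fun x => f x * g x) (hf.continuous.mul hg.continuous)]
  simp only [← flatTorus_laplacian_proj, hfc, hgd] at h
  have h2 : ∀ y, c * f (flatTorus.proj L y) * g (flatTorus.proj L y) -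
      f (flatTorus.proj L y) * (d * g (flatTorus.proj L y)) =
      (c - d) * (f (flatTorus.proj L y) * g (flatTorus.proj L y)) := fun y => by ring
  simp only [h2, integral_const_mul] at h
  exact (mul_eq_zero.1 h).resolve_left (sub_ne_zero.2 hcd)

end Stokes

/-! ### The dual lattice -/

section Dual

variable {n : ℕ} (L : Submodule ℤ (EuclideanSpace ℝ (Fin n)))

/-- The dual lattice. -/
def dualLattice : Submodule ℤ (EuclideanSpace ℝ (Fin n)) :=
  LinearMap.BilinForm.dualSubmodule (innerₗ (EuclideanSpace ℝ (Fin n))) L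

variable {L}

theorem mem_dualLattice {k : EuclideanSpace ℝ (Fin n)} :
    k ∈ dualLattice L ↔ ∀ l ∈ L, ∃ z : ℤ, (z : ℝ) = inner ℝ k l := by
  simp [dualLattice, LinearMap.BilinForm.mem_dualSubmodule, Submodule.mem_one]

theorem innerₗ_nondegenerate :
    LinearMap.BilinForm.Nondegenerate (innerₗ (EuclideanSpace ℝ (Fin n))) :=
  ⟨fun x hx => by simpa using hx x, fun x hx => by simpa using hx x⟩

variable (L)

theorem exists_basis_dualLattice [DiscreteTopology L] [IsZLattice ℝ L] :
    ∃ b : Module.Basis (Fin n) ℝ (EuclideanSpace ℝ (Fin n)),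
      L = Submodule.span ℤ (Set.range b) := by
  have e : Module.Basis (Fin n) ℤ L := Module.finBasisOfFinrankEq ℤ L
    ((ZLattice.rank ℝ L).trans finrank_euclideanSpace_fin)
  exact ⟨e.ofZLatticeBasis ℝ, (e.ofZLatticeBasis_span ℝ).symm⟩

theorem exists_dualLattice_eq_span [DiscreteTopology L] [IsZLattice ℝ L] :
    ∃ b : Module.Basis (Fin n) ℝ (EuclideanSpace ℝ (Fin n)),
      dualLattice L = Submodule.span ℤ (Set.range b) := by
  obtain ⟨b, hb⟩ := exists_basis_dualLattice L
  refine ⟨LinearMap.BilinForm.dualBasis _ innerₗ_nondegenerate b, ?_⟩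
  rw [dualLattice]
  conv_lhs => rw [hb]
  exact LinearMap.BilinForm.dualSubmodule_span_of_basis _ innerₗ_nondegenerate b

theorem dualLattice_dualLattice [DiscreteTopology L] [IsZLattice ℝ L] :
    dualLattice (dualLattice L) = L := by
  obtain ⟨b, hb⟩ := exists_basis_dualLattice L
  rw [dualLattice, dualLattice, hb]
  exact LinearMap.BilinForm.dualSubmodule_dualSubmodule_of_basis _ innerₗ_nondegenerate
    ⟨fun x y => real_inner_comm y x⟩ b

instance [DiscreteTopology L] [IsZLattice ℝ L] : DiscreteTopology (dualLattice L) := by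
  obtain ⟨b, hb⟩ := exists_dualLattice_eq_span L
  rw [hb]
  infer_instance

instance [DiscreteTopology L] [IsZLattice ℝ L] : IsZLattice ℝ (dualLattice L) := by
  obtain ⟨b, hb⟩ := exists_dualLattice_eq_span L
  refine ⟨?_⟩
  rw [hb]
  exact ZSpan.span_top b

variable {L}

/-- This is the inclusion of the bidual lattice in `L`, read contrapositively. It later separates
points of the torus. -/
theorem exists_dual_not_int [DiscreteTopology L] [IsZLattice ℝ L] {x : EuclideanSpace ℝ (Fin n)}
    (hx : x ∉ L) : ∃ k ∈ dualLattice L, ∀ z : ℤ, (z : ℝ) ≠ inner ℝ k x := by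
  rw [← dualLattice_dualLattice L, mem_dualLattice] at hx
  push Not at hx
  obtain ⟨k, hk, h⟩ := hx
  exact ⟨k, hk, fun z => by rw [real_inner_comm]; exact h z⟩

end Dual

/-! ### Real waves: orthogonality and completeness -/

section Hartley

open MeasureTheory

variable {n : ℕ}

/-- The wave `cos (2π⟨k, x⟩) + sin (2π⟨k, x⟩)`. -/
def wave (k x : EuclideanSpace ℝ (Fin n)) : ℝ :=
  Real.cos (2 * Real.pi * inner ℝ k x) + Real.sin (2 * Real.pi * inner ℝ k x)

theorem contDiff_wave (k : EuclideanSpace ℝ (Fin n)) : ContDiff ℝ ∞ (wave k) := by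
  have h : ContDiff ℝ ∞ fun x : EuclideanSpace ℝ (Fin n) => 2 * Real.pi * inner ℝ k x :=
    contDiff_const.mul (contDiff_const.inner ℝ contDiff_id)
  exact h.cos.add h.sin

/-- Products of waves are combinations of waves. This yields both their orthogonality and the
subalgebra needed for the Stone–Weierstrass theorem. -/
theorem wave_mul (k l x : EuclideanSpace ℝ (Fin n)) :
    wave k x * wave l x = (1 / 2 : ℝ) * wave (k - l) x + (1 / 2 : ℝ) * wave (l - k) x +
      (1 / 2 : ℝ) * wave (k + l) x - (1 / 2 : ℝ) * wave (-(k + l)) x := by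
  simp only [wave, inner_add_left, inner_sub_left, inner_neg_left, mul_add, mul_sub, mul_neg,
    Real.cos_neg, Real.sin_neg, Real.cos_add, Real.sin_add, Real.cos_sub, Real.sin_sub]
  ring

theorem wave_zero (x : EuclideanSpace ℝ (Fin n)) : wave 0 x = 1 := by simp [wave]

theorem wave_add_lattice {L : Submodule ℤ (EuclideanSpace ℝ (Fin n))}
    {k l : EuclideanSpace ℝ (Fin n)} (hk : k ∈ dualLattice L) (hl : l ∈ L)
    (x : EuclideanSpace ℝ (Fin n)) : wave k (x + l) = wave k x := by
  obtain ⟨z, hz⟩ := mem_dualLattice.1 hk l hl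
  simp only [wave, inner_add_right, ← hz, mul_add]
  rw [show 2 * Real.pi * (z : ℝ) = z * (2 * Real.pi) by ring, Real.cos_add_int_mul_two_pi,
    Real.sin_add_int_mul_two_pi]

theorem wave_add_half {k t : EuclideanSpace ℝ (Fin n)} (hkt : inner ℝ k t = 1 / 2)
    (x : EuclideanSpace ℝ (Fin n)) : wave k (x + t) = -wave k x := by
  simp only [wave, inner_add_right, hkt, mul_add]
  rw [show 2 * Real.pi * (1 / 2 : ℝ) = Real.pi by ring, Real.cos_add_pi, Real.sin_add_pi]
  ring

/-- The derivative of `cos t + sin t` is `cos t - sin t`, its value at `-t`; hence `-k`. -/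
theorem hasFDerivAt_wave (k x : EuclideanSpace ℝ (Fin n)) :
    HasFDerivAt (wave k) ((2 * Real.pi * wave (-k) x) • innerSL ℝ k) x := by
  have h : HasFDerivAt (fun x : EuclideanSpace ℝ (Fin n) => 2 * Real.pi * inner ℝ k x)
      ((2 * Real.pi) • innerSL ℝ k) x := ((innerSL ℝ k).hasFDerivAt).const_mul (2 * Real.pi)
  refine (h.cos.add h.sin).congr_fderiv ?_
  ext v
  simp [wave]
  ring

theorem euclideanLaplacian_wave (k x : EuclideanSpace ℝ (Fin n)) :
    euclideanLaplacian (wave k) x = 4 * Real.pi ^ 2 * ‖k‖ ^ 2 * wave k x := by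
  have h1 : ∀ v : EuclideanSpace ℝ (Fin n), (fun y => fderiv ℝ (wave k) y v) =
      fun y => (2 * Real.pi * inner ℝ k v) * wave (-k) y := fun v => by
    funext y
    rw [(hasFDerivAt_wave k y).fderiv]
    simp
    ring
  have h2 : ∀ v : EuclideanSpace ℝ (Fin n), fderiv ℝ (fun y => fderiv ℝ (wave k) y v) x v =
      -(4 * Real.pi ^ 2 * (inner ℝ k v) ^ 2 * wave k x) := fun v => by
    rw [h1, ((hasFDerivAt_wave (-k) x).const_mul _).fderiv]
    simp
    ring
  simp only [euclideanLaplacian, h2, Finset.sum_neg_distrib, neg_neg]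
  rw [← Finset.sum_mul, ← Finset.mul_sum, EuclideanSpace.real_norm_sq_eq]
  simp [EuclideanSpace.inner_single_right]

variable (L : Submodule ℤ (EuclideanSpace ℝ (Fin n))) [DiscreteTopology L] [IsZLattice ℝ L]

/-- The wave of a vector of the dual lattice as a function on the torus. -/
def hartley (k : dualLattice L) (p : flatTorus L) : ℝ :=
  wave k (Function.surjInv (flatTorus_proj_surjective L) p)

theorem hartley_proj (k : dualLattice L) (x : EuclideanSpace ℝ (Fin n)) :
    hartley L k (flatTorus.proj L x) = wave k x := by
  have h := (flatTorus_proj_eq_iff L).1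
    (Function.surjInv_eq (flatTorus_proj_surjective L) (flatTorus.proj L x))
  rw [hartley, ← wave_add_lattice k.2 h]
  simp

theorem contMDiff_hartley (k : dualLattice L) : ContMDiff (𝓡 n) 𝓘(ℝ, ℝ) ∞ (hartley L k) :=
  contMDiff_real_of_contDiff_comp_proj L (by simpa only [hartley_proj] using contDiff_wave _)

theorem laplacian_hartley (k : dualLattice L) (p : flatTorus L) :
    (flatTorus L).laplacian (hartley L k) p =
      4 * Real.pi ^ 2 * ‖(k : EuclideanSpace ℝ (Fin n))‖ ^ 2 * hartley L k p := by
  obtain ⟨x, rfl⟩ := flatTorus_proj_surjective L p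
  rw [flatTorus_laplacian_proj]
  simp only [hartley_proj]
  exact euclideanLaplacian_wave _ _

theorem hartley_mul (k l : dualLattice L) (p : flatTorus L) :
    hartley L k p * hartley L l p = (1 / 2 : ℝ) * hartley L (k - l) p +
      (1 / 2 : ℝ) * hartley L (l - k) p + (1 / 2 : ℝ) * hartley L (k + l) p -
      (1 / 2 : ℝ) * hartley L (-(k + l)) p := by
  obtain ⟨x, rfl⟩ := flatTorus_proj_surjective L p
  simp only [hartley_proj]
  exact wave_mul _ _ _

theorem integral_hartley (k : dualLattice L) : ∫ p, hartley L k p ∂(flatTorus L).vol =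
    if k = 0 then (flatTorus L).vol.real Set.univ else 0 := by
  split_ifs with hk
  · have : hartley L k = fun _ => 1 := funext fun p => by
      obtain ⟨x, rfl⟩ := flatTorus_proj_surjective L p
      rw [hartley_proj, hk]
      exact wave_zero x
    rw [this]
    simp
  · obtain ⟨F, hF, -⟩ := exists_isBounded_isAddFundamentalDomain L
    rw [integral_flatTorus L hF (contMDiff_hartley L k).continuous]
    simp only [hartley_proj]
    have hk' : (k : EuclideanSpace ℝ (Fin n)) ≠ 0 := fun h => hk (Subtype.ext h)
    have hn : ‖(k : EuclideanSpace ℝ (Fin n))‖ ^ 2 ≠ 0 := by simpa using hk'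
    -- The vector `t = k / (2‖k‖²)` satisfies `⟨k, t⟩ = 1/2`. Translation by it preserves the
    -- integral but negates the wave, so the integral vanishes.
    have h := setIntegral_comp_add_right L hF (G := wave k) (fun l hl => wave_add_lattice k.2 hl)
      ((1 / (2 * ‖(k : EuclideanSpace ℝ (Fin n))‖ ^ 2)) • (k : EuclideanSpace ℝ (Fin n)))
    have h2 := wave_add_half (n := n) (k := k)
      (t := (1 / (2 * ‖(k : EuclideanSpace ℝ (Fin n))‖ ^ 2)) • (k : EuclideanSpace ℝ (Fin n)))
      (by rw [inner_smul_right, real_inner_self_eq_norm_sq]; field_simp)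
    simp only [h2, integral_neg] at h
    linarith

theorem integrable_of_continuous {f : flatTorus L → ℝ} (hf : Continuous f) :
    Integrable f (flatTorus L).vol := by
  obtain ⟨C, hC⟩ := isCompact_univ.exists_bound_of_continuousOn hf.continuousOn
  exact Integrable.of_bound hf.aestronglyMeasurable C
    (Filter.Eventually.of_forall fun x => hC x (Set.mem_univ x))

theorem memLp_two_of_continuous {f : flatTorus L → ℝ} (hf : Continuous f) :
    MemLp f 2 (flatTorus L).vol := by
  obtain ⟨C, hC⟩ := isCompact_univ.exists_bound_of_continuousOn hf.continuousOn
  exact MemLp.of_bound hf.aestronglyMeasurable C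
    (Filter.Eventually.of_forall fun x => hC x (Set.mem_univ x))

/-- In the product formula the terms `k - l` and `l - k` each contribute half the volume exactly
when `k = l`; the terms `k + l` and `-(k + l)` have equal integrals and opposite signs. -/
theorem integral_hartley_mul (k l : dualLattice L) :
    ∫ p, hartley L k p * hartley L l p ∂(flatTorus L).vol =
      if k = l then (flatTorus L).vol.real Set.univ else 0 := by
  have hi : ∀ m : dualLattice L,
      Integrable (fun p => (1 / 2 : ℝ) * hartley L m p) (flatTorus L).vol := fun m =>
    (integrable_of_continuous L (contMDiff_hartley L m).continuous).const_mul _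
  simp only [hartley_mul]
  rw [integral_sub (((hi _).fun_add (hi _)).fun_add (hi _)) (hi _),
    integral_add ((hi _).fun_add (hi _)) (hi _),
    integral_add (hi _) (hi _)]
  simp only [integral_const_mul, integral_hartley, sub_eq_zero, neg_eq_zero]
  simp only [eq_comm (a := l) (b := k)]
  split_ifs <;> ring

/-- The span of the waves, as an algebra of continuous functions on the torus. -/
def hartleyAlgebra : Subalgebra ℝ C(flatTorus L, ℝ) :=
  Submodule.toSubalgebra (Submodule.span ℝ (Set.range fun k : dualLattice L =>
      (⟨hartley L k, (contMDiff_hartley L k).continuous⟩ : C(flatTorus L, ℝ))))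
    (Submodule.subset_span ⟨0, by
      ext p
      obtain ⟨x, rfl⟩ := flatTorus_proj_surjective L p
      exact (hartley_proj L 0 x).trans (wave_zero x)⟩)
    (by
      intro f g hf hg
      have h := Submodule.mul_mem_mul hf hg
      rw [Submodule.span_mul_span] at h
      refine Submodule.span_le.2 ?_ h
      rintro _ ⟨_, ⟨k, rfl⟩, _, ⟨l, rfl⟩, rfl⟩
      set w : dualLattice L → C(flatTorus L, ℝ) := fun k =>
        ⟨hartley L k, (contMDiff_hartley L k).continuous⟩
      have hw : ∀ m, w m ∈ Submodule.span ℝ (Set.range w) := fun m =>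
        Submodule.subset_span ⟨m, rfl⟩
      have : w k * w l = (1 / 2 : ℝ) • w (k - l) + (1 / 2 : ℝ) • w (l - k) +
          (1 / 2 : ℝ) • w (k + l) - (1 / 2 : ℝ) • w (-(k + l)) := by
        ext p
        exact hartley_mul L k l p
      change w k * w l ∈ Submodule.span ℝ (Set.range w)
      rw [this]
      exact Submodule.sub_mem _ (Submodule.add_mem _ (Submodule.add_mem _
        (Submodule.smul_mem _ _ (hw _)) (Submodule.smul_mem _ _ (hw _)))
        (Submodule.smul_mem _ _ (hw _))) (Submodule.smul_mem _ _ (hw _)))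

/-- If the waves of `k` and `-k` agree at `x` and `y`, so do the cosine and the sine of `2π⟨k, ·⟩`,
and `⟨k, x - y⟩` is an integer. For a suitable `k` it is not. -/
theorem hartleyAlgebra_separatesPoints : (hartleyAlgebra L).SeparatesPoints := by
  intro p q hpq
  obtain ⟨x, rfl⟩ := flatTorus_proj_surjective L p
  obtain ⟨y, rfl⟩ := flatTorus_proj_surjective L q
  have hxy : x - y ∉ L := fun h => hpq ((flatTorus_proj_eq_iff L).2 h).symm
  obtain ⟨k, hk, hz⟩ := exists_dual_not_int hxy
  by_contra hne
  have hs : ∀ m : dualLattice L, wave (m : EuclideanSpace ℝ (Fin n)) x = wave m y := by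
    intro m
    by_contra hm
    refine hne ⟨_, ⟨⟨hartley L m, (contMDiff_hartley L m).continuous⟩,
      Submodule.subset_span ⟨m, rfl⟩, rfl⟩, ?_⟩
    change hartley L m (flatTorus.proj L x) ≠ hartley L m (flatTorus.proj L y)
    rwa [hartley_proj, hartley_proj]
  have h1 := hs ⟨k, hk⟩
  have h2 := hs (-⟨k, hk⟩)
  simp only [wave, Submodule.coe_neg, inner_neg_left, mul_neg, Real.cos_neg, Real.sin_neg] at h1 h2
  have hc : Real.cos (2 * Real.pi * inner ℝ k x) = Real.cos (2 * Real.pi * inner ℝ k y) := by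
    linarith
  have hsn : Real.sin (2 * Real.pi * inner ℝ k x) = Real.sin (2 * Real.pi * inner ℝ k y) := by
    linarith
  obtain ⟨z, hz'⟩ := Real.Angle.angle_eq_iff_two_pi_dvd_sub.1 (Real.Angle.cos_sin_inj hc hsn)
  refine hz z ?_
  rw [inner_sub_right]
  have hpi := Real.pi_pos
  have : 2 * Real.pi * (inner ℝ k x - inner ℝ k y - z) = 0 := by linarith
  have := (mul_eq_zero.1 this).resolve_left (by positivity)
  linarith

instance : SecondCountableTopology (flatTorus L) :=
  ChartedSpace.secondCountable_of_sigmaCompact (EuclideanSpace ℝ (Fin n)) (flatTorus L)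

instance : TopologicalSpace.MetrizableSpace (flatTorus L) :=
  TopologicalSpace.metrizableSpace_of_t3_secondCountable (flatTorus L)

/-- The waves are complete in `L²`. -/
theorem ae_eq_zero_of_integral_mul_hartley {f : flatTorus L → ℝ} (hf : MemLp f 2 (flatTorus L).vol)
    (h0 : ∀ k, ∫ p, f p * hartley L k p ∂(flatTorus L).vol = 0) : f =ᵐ[(flatTorus L).vol] 0 := by
  let μ := (flatTorus L).vol
  let T : C(flatTorus L, ℝ) →L[ℝ] ℝ := (innerSL ℝ (hf.toLp f)).comp (ContinuousMap.toLp 2 μ ℝ)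
  have hT : ∀ g : C(flatTorus L, ℝ), T g = ∫ p, f p * g p ∂μ := fun g => by
    change inner ℝ (hf.toLp f) (ContinuousMap.toLp 2 μ ℝ g) = _
    rw [L2.inner_def]
    refine integral_congr_ae ?_
    filter_upwards [hf.coeFn_toLp, ContinuousMap.coeFn_toLp (p := 2) (𝕜 := ℝ) μ g] with p h1 h2
    rw [h1, h2]
    simp [mul_comm]
  have hA : ∀ g ∈ hartleyAlgebra L, T g = 0 := fun g hg => by
    have hle : Submodule.span ℝ (Set.range fun k : dualLattice L =>
      (⟨hartley L k, (contMDiff_hartley L k).continuous⟩ : C(flatTorus L, ℝ))) ≤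
        LinearMap.ker (T : C(flatTorus L, ℝ) →ₗ[ℝ] ℝ) := by
      rw [Submodule.span_le]
      rintro _ ⟨k, rfl⟩
      exact (hT _).trans (h0 k)
    exact hle hg
  -- By Stone–Weierstrass the wave algebra is dense in `C(flatTorus L, ℝ)`, whose image is dense in
  -- `L²`.
  have hall : ∀ g, T g = 0 := fun g => by
    have hg := ContinuousMap.continuousMap_mem_subalgebra_closure_of_separatesPoints
      (hartleyAlgebra L) (hartleyAlgebra_separatesPoints L) g
    exact closure_minimal (s := (hartleyAlgebra L : Set C(flatTorus L, ℝ))) (t := {g | T g = 0})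
      hA (isClosed_eq T.continuous continuous_const) hg
  have hz : hf.toLp f = 0 := by
    refine (ContinuousMap.toLp_denseRange ℝ μ ℝ (p := 2) (by simp)).eq_zero_of_inner_left ℝ fun g => ?_
    exact hall g
  exact (hf.toLp_eq_toLp_iff MemLp.zero).1 (hz.trans (by simp))

end Hartley

end FlatTorus

/-! ### Comparison of two complete orthonormal systems -/

section OrthonormalSystems

open MeasureTheory

variable {α : Type*} [MeasurableSpace α] {μ : Measure α}

/-- Parseval's identity for a complete orthonormal system of functions. -/
theorem hasSum_integral_mul_integral {e : ℕ → α → ℝ} (he : ∀ i, MemLp (e i) 2 μ)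
    (ho : ∀ j k, ∫ x, e j x * e k x ∂μ = if j = k then 1 else 0)
    (hc : ∀ f : α → ℝ, MemLp f 2 μ → (∀ k, ∫ x, f x * e k x ∂μ = 0) → f =ᵐ[μ] 0)
    {f g : α → ℝ} (hf : MemLp f 2 μ) (hg : MemLp g 2 μ) :
    HasSum (fun i => (∫ x, f x * e i x ∂μ) * ∫ x, g x * e i x ∂μ) (∫ x, f x * g x ∂μ) := by
  have hin : ∀ {u v : α → ℝ} (hu : MemLp u 2 μ) (hv : MemLp v 2 μ),
      inner ℝ (hu.toLp u) (hv.toLp v) = ∫ x, u x * v x ∂μ := fun hu hv => by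
    rw [L2.inner_def]
    refine integral_congr_ae ?_
    filter_upwards [hu.coeFn_toLp, hv.coeFn_toLp] with p h1 h2
    rw [h1, h2]
    simp [mul_comm]
  have hon : Orthonormal ℝ fun i => (he i).toLp (e i) :=
    orthonormal_iff_ite.2 fun i j => by rw [hin, ho]
  have hb : (Submodule.span ℝ (Set.range fun i => (he i).toLp (e i)))ᗮ = ⊥ := by
    rw [Submodule.eq_bot_iff]
    intro u hu
    have hu2 : MemLp u 2 μ := Lp.memLp u
    have h0 := hc u hu2 fun k => by
      rw [← hin hu2 (he k), Lp.toLp_coeFn]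
      exact (Submodule.mem_orthogonal' _ _).1 hu _ (Submodule.subset_span ⟨k, rfl⟩)
    exact (Lp.eq_zero_iff_ae_eq_zero).2 h0
  have h := (HilbertBasis.mkOfOrthogonalEqBot hon hb).hasSum_inner_mul_inner (hf.toLp f) (hg.toLp g)
  simp only [HilbertBasis.coe_mkOfOrthogonalEqBot, hin] at h
  simpa only [mul_comm] using h

variable {e e' : ℕ → α → ℝ} {ev ev' : ℕ → ℝ}

/-- Parseval for `e k` in the system `e'`: only the coefficients with the eigenvalue of `e k`
survive. -/
theorem sum_sq_integral_mul_eq_ite (he : ∀ i, MemLp (e i) 2 μ)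
    (ho : ∀ j k, ∫ x, e j x * e k x ∂μ = if j = k then 1 else 0) (he' : ∀ i, MemLp (e' i) 2 μ)
    (ho' : ∀ j k, ∫ x, e' j x * e' k x ∂μ = if j = k then 1 else 0)
    (hc' : ∀ f : α → ℝ, MemLp f 2 μ → (∀ k, ∫ x, f x * e' k x ∂μ = 0) → f =ᵐ[μ] 0)
    (horth : ∀ j k, ev j ≠ ev' k → ∫ x, e j x * e' k x ∂μ = 0) {c : ℝ} {M : Finset ℕ}
    (hM : ∀ m, m ∈ M ↔ ev' m = c) (k : ℕ) :
    ∑ m ∈ M, (∫ x, e k x * e' m x ∂μ) ^ 2 = if ev k = c then 1 else 0 := by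
  split_ifs with hk
  · have h := hasSum_integral_mul_integral he' ho' hc' (he k) (he k)
    rw [ho, if_pos rfl] at h
    have h2 := hasSum_sum_of_ne_finset_zero (L := .unconditional ℕ) (s := M)
      (f := fun m => (∫ x, e k x * e' m x ∂μ) * ∫ x, e k x * e' m x ∂μ) fun m hm => by
        rw [horth k m fun h => hm ((hM m).2 (h ▸ hk)), zero_mul]
    simpa only [sq] using h2.unique h
  · refine Finset.sum_eq_zero fun m hm => ?_
    rw [horth k m fun h => hk (h.trans ((hM m).1 hm)), sq, zero_mul]

/-- Double counting of the squared coefficients between the two systems: for each `m` in `M` they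
sum over `k` to 1, for a total of `M.card`, while for each `k` they sum over `M` to the indicator of
`ev k = c`. -/
theorem finite_and_card_eq_of_orthogonal (he : ∀ i, MemLp (e i) 2 μ)
    (ho : ∀ j k, ∫ x, e j x * e k x ∂μ = if j = k then 1 else 0)
    (hc : ∀ f : α → ℝ, MemLp f 2 μ → (∀ k, ∫ x, f x * e k x ∂μ = 0) → f =ᵐ[μ] 0)
    (he' : ∀ i, MemLp (e' i) 2 μ)
    (ho' : ∀ j k, ∫ x, e' j x * e' k x ∂μ = if j = k then 1 else 0)
    (hc' : ∀ f : α → ℝ, MemLp f 2 μ → (∀ k, ∫ x, f x * e' k x ∂μ = 0) → f =ᵐ[μ] 0)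
    (horth : ∀ j k, ev j ≠ ev' k → ∫ x, e j x * e' k x ∂μ = 0) {c : ℝ} {M : Finset ℕ}
    (hM : ∀ m, m ∈ M ↔ ev' m = c) :
    ∃ K : Finset ℕ, (∀ k, k ∈ K ↔ ev k = c) ∧ K.card = M.card := by
  have hs : HasSum (fun k => if ev k = c then (1 : ℝ) else 0) M.card := by
    have h : HasSum (fun k => ∑ m ∈ M, (∫ x, e k x * e' m x ∂μ) ^ 2) (∑ _m ∈ M, (1 : ℝ)) := by
      refine hasSum_sum fun m _ => ?_
      have h := hasSum_integral_mul_integral he ho hc (he' m) (he' m)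
      rw [ho', if_pos rfl] at h
      refine h.congr_fun fun k => ?_
      simp only [sq, mul_comm]
    simp only [sum_sq_integral_mul_eq_ite he ho he' ho' hc' horth hM] at h
    simpa using h
  -- A summable indicator function tends to zero along the cofinite filter, so its support is
  -- finite.
  have hfin : {k | ev k = c}.Finite := by
    have h := (hs.summable.tendsto_cofinite_zero).eventually (gt_mem_nhds (zero_lt_one' ℝ))
    refine (Filter.eventually_cofinite.1 h).subset fun k hk => ?_
    have hk' : ev k = c := hk
    simp [hk']
  refine ⟨hfin.toFinset, by simp, ?_⟩
  have h2 : HasSum (fun k => if ev k = c then (1 : ℝ) else 0) (hfin.toFinset.card : ℝ) := by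
    have h := hasSum_sum_of_ne_finset_zero (L := .unconditional ℕ) (s := hfin.toFinset)
      (f := fun k => if ev k = c then (1 : ℝ) else 0) (by simp)
    rwa [Finset.sum_congr rfl (g := fun _ => (1 : ℝ)) (by simp), Finset.sum_const, nsmul_eq_mul,
      mul_one] at h
  exact_mod_cast h2.unique hs

/-- The sum of `∫ a e_k²` over an eigenspace does not depend on the orthonormal system. -/
theorem sum_integral_mul_sq_eq (he : ∀ i, MemLp (e i) 2 μ)
    (ho : ∀ j k, ∫ x, e j x * e k x ∂μ = if j = k then 1 else 0)
    (hc : ∀ f : α → ℝ, MemLp f 2 μ → (∀ k, ∫ x, f x * e k x ∂μ = 0) → f =ᵐ[μ] 0)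
    (he' : ∀ i, MemLp (e' i) 2 μ)
    (ho' : ∀ j k, ∫ x, e' j x * e' k x ∂μ = if j = k then 1 else 0)
    (hc' : ∀ f : α → ℝ, MemLp f 2 μ → (∀ k, ∫ x, f x * e' k x ∂μ = 0) → f =ᵐ[μ] 0)
    (horth : ∀ j k, ev j ≠ ev' k → ∫ x, e j x * e' k x ∂μ = 0) {c : ℝ} {K M : Finset ℕ}
    (hK : ∀ k, k ∈ K ↔ ev k = c) (hM : ∀ m, m ∈ M ↔ ev' m = c) {a : α → ℝ}
    (ha : ∀ m m', Integrable (fun x => a x * (e' m x * e' m' x)) μ) :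
    ∑ k ∈ K, ∫ x, a x * e k x ^ 2 ∂μ = ∑ m ∈ M, ∫ x, a x * e' m x ^ 2 ∂μ := by
  let U : ℕ → ℕ → ℝ := fun k m => ∫ x, e k x * e' m x ∂μ
  have hint : ∀ {u v : α → ℝ}, MemLp u 2 μ → MemLp v 2 μ → Integrable (fun x => u x * v x) μ :=
    fun hu hv => hu.integrable_mul hv
  -- The difference of the two sides is orthogonal to every `e' j`, hence zero by completeness.
  have hexp : ∀ k ∈ K, e k =ᵐ[μ] fun x => ∑ m ∈ M, U k m * e' m x := by
    intro k hk
    have hS : MemLp (fun x => ∑ m ∈ M, U k m * e' m x) 2 μ :=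
      memLp_finsetSum _ fun m _ => (he' m).const_mul _
    have h0 := hc' (fun x => e k x - ∑ m ∈ M, U k m * e' m x) ((he k).sub hS) fun j => by
      have h1 : ∀ x, (e k x - ∑ m ∈ M, U k m * e' m x) * e' j x =
          e k x * e' j x - ∑ m ∈ M, U k m * (e' m x * e' j x) := fun x => by
        rw [sub_mul, Finset.sum_mul]
        simp only [mul_assoc]
      simp only [h1]
      rw [integral_sub (hint (he k) (he' j))
        (integrable_finsetSum _ fun m _ => (hint (he' m) (he' j)).const_mul _),
        integral_finsetSum _ fun m _ => (hint (he' m) (he' j)).const_mul _]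
      simp only [integral_const_mul, ho', mul_ite, mul_one, mul_zero, Finset.sum_ite_eq']
      split_ifs with hj
      · exact sub_self _
      · rw [sub_zero]
        exact horth k j fun h => hj ((hM j).2 (h ▸ (hK k).1 hk))
    filter_upwards [h0] with x hx
    exact sub_eq_zero.1 hx
  have hsq : ∀ k ∈ K, ∫ x, a x * e k x ^ 2 ∂μ =
      ∑ m ∈ M, ∑ m' ∈ M, U k m * U k m' * ∫ x, a x * (e' m x * e' m' x) ∂μ := by
    intro k hk
    have h1 : (fun x => a x * e k x ^ 2) =ᵐ[μ] fun x =>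
        ∑ m ∈ M, ∑ m' ∈ M, U k m * U k m' * (a x * (e' m x * e' m' x)) := by
      filter_upwards [hexp k hk] with x hx
      rw [hx, sq, Finset.sum_mul_sum, Finset.mul_sum]
      refine Finset.sum_congr rfl fun m _ => ?_
      rw [Finset.mul_sum]
      exact Finset.sum_congr rfl fun m' _ => by ring
    rw [integral_congr_ae h1, integral_finsetSum _ fun m _ =>
      integrable_finsetSum _ fun m' _ => (ha m m').const_mul _]
    refine Finset.sum_congr rfl fun m _ => ?_
    rw [integral_finsetSum _ fun m' _ => (ha m m').const_mul _]
    simp only [integral_const_mul]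
  -- Parseval in the system `e`: the change-of-basis matrix `U` is orthogonal, so only the diagonal
  -- terms of the double sum remain.
  have hdelta : ∀ m ∈ M, ∀ m', ∑ k ∈ K, U k m * U k m' = if m = m' then 1 else 0 := by
    intro m hm m'
    rw [← ho']
    have h := hasSum_integral_mul_integral he ho hc (he' m) (he' m')
    have h2 := hasSum_sum_of_ne_finset_zero (L := .unconditional ℕ) (s := K)
      (f := fun k => (∫ x, e' m x * e k x ∂μ) * ∫ x, e' m' x * e k x ∂μ) fun k hk => by
        simp only [mul_comm (e' m _)]
        rw [horth k m fun h => hk ((hK k).2 (h.trans ((hM m).1 hm))), zero_mul]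
    rw [← h2.unique h]
    simp only [U, mul_comm (e' _ _)]
  rw [Finset.sum_congr rfl hsq, Finset.sum_comm]
  refine Finset.sum_congr rfl fun m hm => ?_
  rw [Finset.sum_comm]
  simp only [← Finset.sum_mul, hdelta m hm, ite_mul, one_mul, zero_mul, Finset.sum_ite_eq, if_pos hm,
    sq]

end OrthonormalSystems

namespace FlatTorus

/-! ### Spectrum and eigenspace traces of a flat torus -/

section Spectrum

open MeasureTheory

variable {n : ℕ} (L : Submodule ℤ (EuclideanSpace ℝ (Fin n))) [DiscreteTopology L]
  [IsZLattice ℝ L]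

theorem vol_real_univ_pos : 0 < (flatTorus L).vol.real Set.univ := by
  have : NeZero (flatTorus L).vol := ⟨flatTorus_vol_ne_zero L⟩
  exact measureReal_univ_pos

/-- The complete orthonormal system of waves on a flat torus. -/
def hartleyBasis (e : ℕ ≃ dualLattice L) : (flatTorus L).EigenBasis where
  eigenvalue k := 4 * Real.pi ^ 2 * ‖(e k : EuclideanSpace ℝ (Fin n))‖ ^ 2
  eigenfunction k p := (√((flatTorus L).vol.real Set.univ))⁻¹ * hartley L (e k) p
  smooth k := contMDiff_real_of_contDiff_comp_proj L
    (contDiff_const.mul (contDiff_comp_proj L (contMDiff_hartley L (e k))))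
  laplacian_eq k p := by
    obtain ⟨x, rfl⟩ := flatTorus_proj_surjective L p
    rw [mul_left_comm, ← laplacian_hartley, flatTorus_laplacian_proj, flatTorus_laplacian_proj]
    set f : EuclideanSpace ℝ (Fin n) → ℝ := fun y => hartley L (e k) (flatTorus.proj L y)
    set c := (√((flatTorus L).vol.real Set.univ))⁻¹
    have hf : ContDiff ℝ ∞ f := contDiff_comp_proj L (contMDiff_hartley L (e k))
    have h1 : ∀ v : EuclideanSpace ℝ (Fin n), (fun y => fderiv ℝ (fun y => c * f y) y v) =
        fun y => c * fderiv ℝ f y v := fun v => funext fun y => by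
      rw [fderiv_const_mul (hf.differentiable (by simp) y)]
      rfl
    have h2 : ∀ v : EuclideanSpace ℝ (Fin n),
        fderiv ℝ (fun y => c * fderiv ℝ f y v) x v = c * fderiv ℝ (fun y => fderiv ℝ f y v) x v := by
      intro v
      have : ContDiff ℝ ∞ fun y => fderiv ℝ f y v :=
        (hf.fderiv_right (m := ∞) (by simp)).clm_apply contDiff_const
      rw [fderiv_const_mul (this.differentiable (by simp) x)]
      rfl
    change euclideanLaplacian (fun y => c * f y) x = c * euclideanLaplacian f x
    simp only [euclideanLaplacian, h1, h2, ← Finset.mul_sum, mul_neg]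
  orthonormal j k := by
    have hV := vol_real_univ_pos L
    have h : ∀ p, (√((flatTorus L).vol.real Set.univ))⁻¹ * hartley L (e j) p *
        ((√((flatTorus L).vol.real Set.univ))⁻¹ * hartley L (e k) p) =
        ((flatTorus L).vol.real Set.univ)⁻¹ * (hartley L (e j) p * hartley L (e k) p) := fun p => by
      rw [mul_mul_mul_comm, ← mul_inv, Real.mul_self_sqrt hV.le]
    simp only [h, integral_const_mul, integral_hartley_mul, e.injective.eq_iff]
    split_ifs
    · exact inv_mul_cancel₀ hV.ne'
    · exact mul_zero _
  complete f hf h0 := by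
    refine ae_eq_zero_of_integral_mul_hartley L hf fun k => ?_
    have h := h0 (e.symm k)
    simp only [Equiv.apply_symm_apply, mul_left_comm (f _), integral_const_mul] at h
    refine (mul_eq_zero.1 h).resolve_left (inv_ne_zero (Real.sqrt_ne_zero'.2 (vol_real_univ_pos L)))

theorem nonempty_equiv_dualLattice (hn : 0 < n) : Nonempty (ℕ ≃ dualLattice L) := by
  have : NeZero n := ⟨hn.ne'⟩
  have hfr : Module.finrank ℤ (dualLattice L) = n :=
    (ZLattice.rank ℝ (dualLattice L)).trans finrank_euclideanSpace_fin
  have e := (Module.finBasisOfFinrankEq ℤ (dualLattice L) hfr).equivFun.toEquiv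
  have : Infinite (dualLattice L) := e.infinite_iff.2 inferInstance
  obtain ⟨d⟩ := nonempty_denumerable (dualLattice L)
  exact ⟨d.eqv.symm⟩

theorem finite_dualLattice_norm_eq (c : ℝ) :
    {k : dualLattice L | 4 * Real.pi ^ 2 * ‖(k : EuclideanSpace ℝ (Fin n))‖ ^ 2 = c}.Finite := by
  obtain ⟨b, hb⟩ := exists_dualLattice_eq_span L
  -- Since `4π² ≥ 1`, the equation forces `‖k‖² ≤ c`, which gives the radius `√c`.
  have h := ZSpan.setFinite_inter b
    (Metric.isBounded_closedBall (x := (0 : EuclideanSpace ℝ (Fin n))) (r := √c))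
  rw [← hb] at h
  refine Set.Finite.of_finite_image (h.subset ?_) Subtype.val_injective.injOn
  rintro _ ⟨k, hk, rfl⟩
  refine ⟨?_, k.2⟩
  rw [mem_closedBall_zero_iff]
  refine Real.le_sqrt_of_sq_le ?_
  have hk' : 4 * Real.pi ^ 2 * ‖(k : EuclideanSpace ℝ (Fin n))‖ ^ 2 = c := hk
  have : (1 : ℝ) ≤ Real.pi ^ 2 := by nlinarith [Real.pi_gt_three]
  nlinarith [sq_nonneg ‖(k : EuclideanSpace ℝ (Fin n))‖]

/-- The index set is symmetric under `k ↦ -k`, and `(cos + sin)² + (cos - sin)² = 2`. This constancy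
is why the trace of `a` sees only the mean of `a`. -/
theorem sum_hartley_sq {c : ℝ} {N : Finset (dualLattice L)} (hN : ∀ k, k ∈ N ↔
    4 * Real.pi ^ 2 * ‖(k : EuclideanSpace ℝ (Fin n))‖ ^ 2 = c) (p : flatTorus L) :
    ∑ k ∈ N, hartley L k p ^ 2 = N.card := by
  have h1 : ∑ k ∈ N, hartley L k p ^ 2 = ∑ k ∈ N, hartley L (-k) p ^ 2 :=
    Finset.sum_nbij' (fun k => -k) (fun k => -k) (fun k hk => by
        rw [hN] at hk ⊢
        simpa using hk) (fun k hk => by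
        rw [hN] at hk ⊢
        simpa using hk) (by simp) (by simp) (by simp)
  have h2 : ∀ k, hartley L k p ^ 2 + hartley L (-k) p ^ 2 = 2 := fun k => by
    obtain ⟨x, rfl⟩ := flatTorus_proj_surjective L p
    rw [hartley_proj, hartley_proj]
    simp only [wave, Submodule.coe_neg, inner_neg_left, mul_neg, Real.cos_neg, Real.sin_neg]
    linear_combination 2 * Real.sin_sq_add_cos_sq (2 * Real.pi * inner ℝ (k : EuclideanSpace ℝ (Fin n)) x)
  have h3 : ∑ k ∈ N, hartley L k p ^ 2 + ∑ k ∈ N, hartley L (-k) p ^ 2 = 2 * N.card := by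
    rw [← Finset.sum_add_distrib, Finset.sum_congr rfl fun k _ => h2 k]
    simp [mul_comm]
  linarith

variable {L}

theorem memLp_eigenfunction (B : (flatTorus L).EigenBasis) (k : ℕ) :
    MemLp (B.eigenfunction k) 2 (flatTorus L).vol :=
  memLp_two_of_continuous L (B.smooth k).continuous

theorem integral_eigenfunction_mul (B B' : (flatTorus L).EigenBasis) (j k : ℕ)
    (h : B.eigenvalue j ≠ B'.eigenvalue k) :
    ∫ x, B.eigenfunction j x * B'.eigenfunction k x ∂(flatTorus L).vol = 0 :=
  integral_laplacian_mul L (B.smooth j) (B'.smooth k) (B.laplacian_eq j) (B'.laplacian_eq k) h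

theorem exists_finset_hartleyBasis (e : ℕ ≃ dualLattice L) (c : ℝ) :
    ∃ M : Finset ℕ, ∀ m, m ∈ M ↔ (hartleyBasis L e).eigenvalue m = c :=
  ⟨((finite_dualLattice_norm_eq L c).preimage e.injective.injOn).toFinset, fun m => by
    simp [hartleyBasis]⟩

theorem exists_finset_eigenvalue_eq (B : (flatTorus L).EigenBasis) (e : ℕ ≃ dualLattice L) (c : ℝ)
    {M : Finset ℕ} (hM : ∀ m, m ∈ M ↔ (hartleyBasis L e).eigenvalue m = c) :
    ∃ K : Finset ℕ, (∀ k, k ∈ K ↔ B.eigenvalue k = c) ∧ K.card = M.card :=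
  finite_and_card_eq_of_orthogonal (memLp_eigenfunction B) B.orthonormal B.complete
    (memLp_eigenfunction _) (hartleyBasis L e).orthonormal (hartleyBasis L e).complete
    (integral_eigenfunction_mul B _) hM

/-- The spectrum of a flat torus. -/
theorem exists_equiv_eigenvalue_eq (hn : 0 < n) (B : (flatTorus L).EigenBasis) :
    ∃ τ : ℕ ≃ dualLattice L, ∀ k,
      B.eigenvalue k = 4 * Real.pi ^ 2 * ‖(τ k : EuclideanSpace ℝ (Fin n))‖ ^ 2 := by
  obtain ⟨e⟩ := nonempty_equiv_dualLattice L hn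
  have h : ∀ c, Nonempty ({k // B.eigenvalue k = c} ≃ {m // (hartleyBasis L e).eigenvalue m = c}) := by
    intro c
    obtain ⟨M, hM⟩ := exists_finset_hartleyBasis e c
    obtain ⟨K, hK, hKM⟩ := exists_finset_eigenvalue_eq B e c hM
    exact ⟨((Equiv.subtypeEquivRight hK).symm.trans (Finset.equivOfCardEq hKM)).trans
      (Equiv.subtypeEquivRight hM)⟩
  refine ⟨(Equiv.ofFiberEquiv fun c => (h c).some).trans e, fun k => ?_⟩
  exact (Equiv.ofFiberEquiv_map (fun c => (h c).some) k).symm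

/-- The trace on the eigenspace may be computed with the waves, and the sum of their squares is
constant. -/
theorem exists_sum_integral_mul_eigenfunction_sq (hn : 0 < n) (B : (flatTorus L).EigenBasis)
    {a : flatTorus L → ℝ} (ha : Continuous a) (c : ℝ) :
    ∃ K : Finset ℕ, (∀ k, k ∈ K ↔ B.eigenvalue k = c) ∧
      ∑ k ∈ K, ∫ x, a x * B.eigenfunction k x ^ 2 ∂(flatTorus L).vol =
        ∑ _k ∈ K, (∫ x, a x ∂(flatTorus L).vol) / (flatTorus L).vol.real Set.univ := by
  obtain ⟨e⟩ := nonempty_equiv_dualLattice L hn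
  obtain ⟨M, hM⟩ := exists_finset_hartleyBasis e c
  obtain ⟨K, hK, hKM⟩ := exists_finset_eigenvalue_eq B e c hM
  refine ⟨K, hK, ?_⟩
  have hV := vol_real_univ_pos L
  have hcont : ∀ m, Continuous ((hartleyBasis L e).eigenfunction m) := fun m =>
    ((hartleyBasis L e).smooth m).continuous
  rw [sum_integral_mul_sq_eq (memLp_eigenfunction B) B.orthonormal B.complete
    (memLp_eigenfunction _) (hartleyBasis L e).orthonormal (hartleyBasis L e).complete
    (integral_eigenfunction_mul B _) hK hM fun m m' =>
      integrable_of_continuous L (ha.mul ((hcont m).mul (hcont m')))]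
  have hint : ∀ m ∈ M, Integrable (fun x => a x * (hartleyBasis L e).eigenfunction m x ^ 2)
      (flatTorus L).vol := fun m _ => integrable_of_continuous L (ha.mul ((hcont m).pow 2))
  rw [← integral_finsetSum _ hint]
  have hpt : ∀ x, ∑ m ∈ M, a x * (hartleyBasis L e).eigenfunction m x ^ 2 =
      (M.card / (flatTorus L).vol.real Set.univ) * a x := by
    intro x
    have h := sum_hartley_sq L (N := M.map e.toEmbedding) (c := c) (fun k => by
      rw [Finset.mem_map_equiv, hM]
      simp [hartleyBasis]) x
    rw [Finset.sum_map, Finset.card_map] at h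
    simp only [hartleyBasis, mul_pow, inv_pow, Real.sq_sqrt hV.le, ← Finset.mul_sum]
    rw [show ∑ m ∈ M, hartley L (e m) x ^ 2 = M.card from h]
    field_simp
  simp only [hpt, integral_const_mul, Finset.sum_const, nsmul_eq_mul, hKM]
  ring

end Spectrum

/-! ### The Dirichlet series -/

section Zeta

open MeasureTheory

variable {n : ℕ} {L : Submodule ℤ (EuclideanSpace ℝ (Fin n))} [DiscreteTopology L]
  [IsZLattice ℝ L]

/-- The factor `λ^(-s)` of the Dirichlet series, with `0` for the eigenvalue `0`. -/
def zetaFactor (s : ℂ) (c : ℝ) : ℂ := if c = 0 then 0 else (c : ℂ) ^ (-s)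

theorem zetaTerm_eq (B : (flatTorus L).EigenBasis) (a : flatTorus L → ℝ) (s : ℂ) (k : ℕ) :
    B.zetaTerm a s k = zetaFactor s (B.eigenvalue k) *
      ((∫ x, a x * B.eigenfunction k x ^ 2 ∂(flatTorus L).vol : ℝ) : ℂ) := by
  rw [ClosedRiemannianManifold.EigenBasis.zetaTerm, zetaFactor]
  split_ifs <;> simp

/-- Up to a constant the terms are `‖k‖ ^ (-2 Re s)`, summable over a lattice of rank `n` because `2
Re s > n`. -/
theorem summable_norm_zetaFactor_dualLattice {s : ℂ} (hs : (n : ℝ) / 2 < s.re) :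
    Summable fun k : dualLattice L =>
      ‖zetaFactor s (4 * Real.pi ^ 2 * ‖(k : EuclideanSpace ℝ (Fin n))‖ ^ 2)‖ := by
  have hfr : Module.finrank ℤ (dualLattice L) = n :=
    (ZLattice.rank ℝ (dualLattice L)).trans finrank_euclideanSpace_fin
  have h := (ZLattice.summable_norm_rpow (dualLattice L) (-2 * s.re) (by
    rw [hfr]; linarith)).mul_left ((4 * Real.pi ^ 2) ^ (-s.re))
  refine h.of_nonneg_of_le (fun _ => norm_nonneg _) fun k => ?_
  rw [zetaFactor]
  split_ifs with hk
  · rw [norm_zero]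
    positivity
  · have hk0 : (0 : ℝ) < ‖(k : EuclideanSpace ℝ (Fin n))‖ := by
      rw [norm_pos_iff]
      rintro h0
      simp [h0] at hk
    have hsq : (‖(k : EuclideanSpace ℝ (Fin n))‖ ^ 2) ^ (-s.re) =
        ‖(k : EuclideanSpace ℝ (Fin n))‖ ^ (-2 * s.re) := by
      rw [← Real.rpow_two, ← Real.rpow_mul hk0.le]
      ring_nf
    rw [Complex.norm_cpow_eq_rpow_re_of_pos (by positivity), Complex.neg_re,
      Real.mul_rpow (by positivity) (by positivity), hsq]
    exact le_rfl

theorem norm_integral_mul_eigenfunction_sq_le (B : (flatTorus L).EigenBasis) {a : flatTorus L → ℝ}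
    (ha : Continuous a) :
    ∃ C : ℝ, ∀ k, |∫ x, a x * B.eigenfunction k x ^ 2 ∂(flatTorus L).vol| ≤ C := by
  obtain ⟨C, hC⟩ := isCompact_univ.exists_bound_of_continuousOn ha.continuousOn
  refine ⟨C, fun k => ?_⟩
  have hb := (B.smooth k).continuous
  have h1 : ∫ x, B.eigenfunction k x ^ 2 ∂(flatTorus L).vol = 1 := by
    simpa [sq] using B.orthonormal k k
  calc |∫ x, a x * B.eigenfunction k x ^ 2 ∂(flatTorus L).vol|
      ≤ ∫ x, C * B.eigenfunction k x ^ 2 ∂(flatTorus L).vol := by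
        rw [← Real.norm_eq_abs]
        refine norm_integral_le_of_norm_le
          (integrable_of_continuous L (continuous_const.mul (hb.pow 2)))
          (Filter.Eventually.of_forall fun x => ?_)
        rw [norm_mul, norm_pow, Real.norm_eq_abs (B.eigenfunction k x), sq_abs]
        exact mul_le_mul_of_nonneg_right (hC x (Set.mem_univ x)) (sq_nonneg _)
    _ = C := by rw [integral_const_mul, h1, mul_one]

/-- On a flat torus, `tr(a Δ^(-s))` is the mean of `a` times the Epstein zeta function of the dual
lattice. -/
theorem summable_zetaTerm_and_tsum_eq (hn : 0 < n) (B : (flatTorus L).EigenBasis)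
    {a : flatTorus L → ℝ} (ha : Continuous a) {s : ℂ} (hs : (n : ℝ) / 2 < s.re) :
    Summable (B.zetaTerm a s) ∧ ∑' k, B.zetaTerm a s k =
      ∑' k : dualLattice L, zetaFactor s (4 * Real.pi ^ 2 * ‖(k : EuclideanSpace ℝ (Fin n))‖ ^ 2) *
        (((∫ x, a x ∂(flatTorus L).vol) / (flatTorus L).vol.real Set.univ : ℝ) : ℂ) := by
  obtain ⟨τ, hτ⟩ := exists_equiv_eigenvalue_eq hn B
  set A : ℝ := (∫ x, a x ∂(flatTorus L).vol) / (flatTorus L).vol.real Set.univ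
  have hnorm : Summable fun k => ‖zetaFactor s (B.eigenvalue k)‖ := by
    simp only [hτ]
    exact τ.summable_iff.2 (summable_norm_zetaFactor_dualLattice hs)
  obtain ⟨C, hC⟩ := norm_integral_mul_eigenfunction_sq_le B ha
  have hsum : Summable (B.zetaTerm a s) := by
    refine Summable.of_norm_bounded (hnorm.mul_right C) fun k => ?_
    rw [zetaTerm_eq, norm_mul, Complex.norm_real]
    exact mul_le_mul_of_nonneg_left (hC k) (norm_nonneg _)
  have hsum' : Summable fun k => zetaFactor s (B.eigenvalue k) * (A : ℂ) :=
    hnorm.of_norm.mul_right _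
  refine ⟨hsum, ?_⟩
  have hre : ∑' k : dualLattice L,
      zetaFactor s (4 * Real.pi ^ 2 * ‖(k : EuclideanSpace ℝ (Fin n))‖ ^ 2) * (A : ℂ) =
      ∑' k, zetaFactor s (B.eigenvalue k) * (A : ℂ) := by
    rw [← τ.tsum_eq]
    simp only [hτ]
  rw [hre, ← sub_eq_zero, ← hsum.tsum_sub hsum']
  have hdiff := hsum.sub hsum'
  -- The two series need not agree term by term. Summability of their difference allows regrouping
  -- by eigenvalue, and each eigenspace contributes zero.
  refine ((Equiv.sigmaFiberEquiv B.eigenvalue).tsum_eq _).symm.trans ?_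
  refine ((Equiv.sigmaFiberEquiv B.eigenvalue).summable_iff.2 hdiff).tsum_sigma.trans ?_
  refine (tsum_congr fun c => ?_).trans tsum_zero
  obtain ⟨K, hK, hsumK⟩ := exists_sum_integral_mul_eigenfunction_sq hn B ha c
  change ∑' k : {k // B.eigenvalue k = c},
    (B.zetaTerm a s k - zetaFactor s (B.eigenvalue k) * (A : ℂ)) = 0
  rw [← (Equiv.subtypeEquivRight hK).tsum_eq]
  change ∑' k : {k // k ∈ K}, (B.zetaTerm a s k - zetaFactor s (B.eigenvalue k) * (A : ℂ)) = 0
  rw [Finset.tsum_subtype K fun k => B.zetaTerm a s k - zetaFactor s (B.eigenvalue k) * (A : ℂ)]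
  have h : ∀ k ∈ K, B.zetaTerm a s k - zetaFactor s (B.eigenvalue k) * (A : ℂ) = zetaFactor s c *
      (((∫ x, a x * B.eigenfunction k x ^ 2 ∂(flatTorus L).vol : ℝ) : ℂ) - (A : ℂ)) := by
    intro k hk
    rw [zetaTerm_eq, (hK k).1 hk, mul_sub]
  rw [Finset.sum_congr rfl h, ← Finset.mul_sum, Finset.sum_sub_distrib]
  rw [← Complex.ofReal_sum, hsumK, Complex.ofReal_sum, sub_self, mul_zero]

end Zeta

end FlatTorus

-- Equality on the half-plane makes the defining predicates equal, so the same function is chosen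
-- for both. Equality of zeta functions thus requires no proof that a continuation exists.
open Classical in
theorem ClosedRiemannianManifold.meromorphicExtension_congr {σ : ℝ} {D D' : ℂ → ℂ}
    (h : ∀ s : ℂ, σ < s.re → D s = D' s) :
    meromorphicExtension σ D = meromorphicExtension σ D' := by
  have h1 : (fun F : ℂ → ℂ => MeromorphicNFOn F Set.univ ∧ ∀ s : ℂ, σ < s.re → F s = D s) =
      fun F : ℂ → ℂ => MeromorphicNFOn F Set.univ ∧ ∀ s : ℂ, σ < s.re → F s = D' s := by
    funext F
    refine propext (and_congr_right fun _ => forall₂_congr fun s hs => ?_)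
    rw [h s hs]
  have h2 : (fun s : ℂ => if σ < s.re then D s else 0) = fun s => if σ < s.re then D' s else 0 := by
    funext s
    split_ifs with hs
    exacts [h s hs, rfl]
  have key : ∀ P P' : (ℂ → ℂ) → Prop, P = P' → ∀ g g' : ℂ → ℂ, g = g' →
      (if h : ∃ F, P F then h.choose else g) = if h : ∃ F, P' F then h.choose else g' := by
    rintro _ _ rfl _ _ rfl
    rfl
  exact key _ _ h1 _ _ h2

namespace FlatTorus

/-! ### Lifting isometries to Euclidean space -/

section Lift

variable {n : ℕ} {L L' : Submodule ℤ (EuclideanSpace ℝ (Fin n))} [DiscreteTopology L]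
  [IsZLattice ℝ L] [DiscreteTopology L'] [IsZLattice ℝ L']

variable (L) in
theorem isCoveringMap_flatTorus_proj : IsCoveringMap (flatTorus.proj L) := by
  have : IsDiscrete (L.toAddSubgroup : Set (EuclideanSpace ℝ (Fin n))) := ⟨‹DiscreteTopology L›⟩
  exact (L.toAddSubgroup.isAddQuotientCoveringMap_of_comm this).isCoveringMap

theorem exists_lift {f : flatTorus L → flatTorus L'} (hf : Continuous f)
    {x y : EuclideanSpace ℝ (Fin n)} (h : flatTorus.proj L' y = f (flatTorus.proj L x)) :
    ∃ F : EuclideanSpace ℝ (Fin n) → EuclideanSpace ℝ (Fin n), Continuous F ∧ F x = y ∧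
      ∀ z, flatTorus.proj L' (F z) = f (flatTorus.proj L z) := by
  obtain ⟨F, ⟨h1, h2⟩, -⟩ := (isCoveringMap_flatTorus_proj L').existsUnique_continuousMap_lifts
    ⟨fun z => f (flatTorus.proj L z), hf.comp (continuous_flatTorus_proj L)⟩ x y h
  exact ⟨F, F.continuous, h1, fun z => congrFun h2 z⟩

/-- Near each point the lift is a chart composed with `f` and the projection, up to a constant
translation. -/
theorem contDiff_lift {f : flatTorus L → flatTorus L'} (hf : ContMDiff (𝓡 n) (𝓡 n) ∞ f)
    {F : EuclideanSpace ℝ (Fin n) → EuclideanSpace ℝ (Fin n)} (hF : Continuous F)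
    (h : ∀ z, flatTorus.proj L' (F z) = f (flatTorus.proj L z)) : ContDiff ℝ ∞ F := by
  rw [contDiff_iff_contDiffAt]
  intro x
  set p := flatTorus.proj L' (F x)
  set e := (flatTorus L').chart p
  have h1 : ContMDiffAt (𝓡 n) (𝓡 n) ∞ e p :=
    contMDiffOn_chart.contMDiffAt (e.open_source.mem_nhds (mem_chart_source _ p))
  have hg : ContMDiffAt (𝓡 n) (𝓡 n) ∞ (fun z => f (flatTorus.proj L z)) x :=
    (hf.comp (contMDiff_flatTorus_proj L)).contMDiffAt
  have h2 : ContDiffAt ℝ ∞ (fun z => e (f (flatTorus.proj L z))) x := by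
    refine contMDiffAt_iff_contDiffAt.1 (ContMDiffAt.comp x ?_ hg)
    rw [← h x]
    exact h1
  have h3 : (fun y => e (flatTorus.proj L' y)) =ᶠ[nhds (F x)] fun y => y + (e p - F x) :=
    chart_proj_eventuallyEq L' (chart_mem_atlas (EuclideanSpace ℝ (Fin n)) (p : Carrier L'))
      (mem_chart_source (EuclideanSpace ℝ (Fin n)) (p : Carrier L'))
  refine (h2.sub (contDiffAt_const (c := e p - F x))).congr_of_eventuallyEq ?_
  filter_upwards [hF.continuousAt.eventually h3] with z hz
  rw [← h z, hz, add_sub_cancel_right]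

/-- Both projections have the identity as differential, so the derivative of `F` is that of `f` and
preserves lengths; the mean value inequality does the rest. -/
theorem lipschitzWith_one_lift {f : flatTorus L → flatTorus L'} (hf : ContMDiff (𝓡 n) (𝓡 n) ∞ f)
    (hm : ∀ (x : flatTorus L) (v w : TangentSpace (𝓡 n) x),
      (flatTorus L').metric.inner (f x) (mfderiv (𝓡 n) (𝓡 n) f x v) (mfderiv (𝓡 n) (𝓡 n) f x w) =
        (flatTorus L).metric.inner x v w)
    {F : EuclideanSpace ℝ (Fin n) → EuclideanSpace ℝ (Fin n)} (hF : Continuous F)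
    (h : ∀ z, flatTorus.proj L' (F z) = f (flatTorus.proj L z)) : LipschitzWith 1 F := by
  have hF' := contDiff_lift hf hF h
  refine lipschitzWith_of_nnnorm_fderiv_le (𝕜 := ℝ) (hF'.differentiable (by simp)) fun x => ?_
  refine ContinuousLinearMap.opNNNorm_le_bound _ _ fun v => ?_
  have hchain : mfderiv (𝓡 n) (𝓡 n) (fun z => flatTorus.proj L' (F z)) x v =
      mfderiv (𝓡 n) (𝓡 n) (fun z => f (flatTorus.proj L z)) x v := by
    rw [show (fun z => flatTorus.proj L' (F z)) = fun z => f (flatTorus.proj L z) from funext h]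
    rfl
  have hl : mfderiv (𝓡 n) (𝓡 n) (fun z => flatTorus.proj L' (F z)) x v = fderiv ℝ F x v := by
    refine (mfderiv_comp_apply x (I := 𝓡 n) (I' := 𝓡 n) (I'' := 𝓡 n) (f := F)
      ((contMDiff_flatTorus_proj L').mdifferentiableAt (by simp))
      (hF'.contMDiff.mdifferentiableAt (by simp)) v).trans ?_
    rw [mfderiv_eq_fderiv]
    exact mfderiv_proj_apply L' (F x) _
  have hr : mfderiv (𝓡 n) (𝓡 n) (fun z => f (flatTorus.proj L z)) x v =
      mfderiv (𝓡 n) (𝓡 n) f (flatTorus.proj L x) v := by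
    refine (mfderiv_comp_apply x (I := 𝓡 n) (I' := 𝓡 n) (I'' := 𝓡 n) (g := f)
      (hf.mdifferentiableAt (by simp))
      ((contMDiff_flatTorus_proj L).mdifferentiableAt (by simp)) v).trans ?_
    exact congrArg (mfderiv (𝓡 n) (𝓡 n) f (flatTorus.proj L x)) (mfderiv_proj_apply L x v)
  have hD : fderiv ℝ F x v = mfderiv (𝓡 n) (𝓡 n) f (flatTorus.proj L x) v :=
    hl.symm.trans (hchain.trans hr)
  have hinner : inner ℝ (fderiv ℝ F x v) (fderiv ℝ F x v) = inner ℝ v v :=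
    (congrArg₂ (fun a b => euclideanForm n a b) hD hD).trans (hm (flatTorus.proj L x) v v)
  rw [real_inner_self_eq_norm_sq, real_inner_self_eq_norm_sq] at hinner
  rw [one_mul]
  exact ((sq_eq_sq₀ (norm_nonneg _) (norm_nonneg _)).1 hinner).le

/-- An isometry of flat tori lifts to an affine isometry, whose linear part maps one lattice into
the other one. -/
theorem exists_linearIsometryEquiv_of_isometric (hiso : (flatTorus L).Isometric (flatTorus L')) :
    ∃ U : EuclideanSpace ℝ (Fin n) ≃ₗᵢ[ℝ] EuclideanSpace ℝ (Fin n), ∀ l ∈ L, U l ∈ L' := by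
  obtain ⟨ψ, hψ⟩ := hiso
  have hψs : ∀ (y : flatTorus L') (v w : TangentSpace (𝓡 n) y),
      (flatTorus L).metric.inner (ψ.symm y) (mfderiv (𝓡 n) (𝓡 n) ψ.symm y v)
        (mfderiv (𝓡 n) (𝓡 n) ψ.symm y w) = (flatTorus L').metric.inner y v w := by
    intro y v w
    have hid : ∀ u : TangentSpace (𝓡 n) y,
        mfderiv (𝓡 n) (𝓡 n) ψ (ψ.symm y) (mfderiv (𝓡 n) (𝓡 n) ψ.symm y u) = u := by
      intro u
      rw [← mfderiv_comp_apply y (ψ.contMDiff.mdifferentiableAt (by simp))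
        (ψ.symm.contMDiff.mdifferentiableAt (by simp))]
      have : (ψ ∘ ψ.symm : flatTorus L' → flatTorus L') = id := funext ψ.apply_symm_apply
      rw [this, mfderiv_id]
      rfl
    have h := hψ (ψ.symm y) (mfderiv (𝓡 n) (𝓡 n) ψ.symm y v) (mfderiv (𝓡 n) (𝓡 n) ψ.symm y w)
    rw [← h]
    exact congrArg₂ (fun a b => euclideanForm n a b) (hid v) (hid w)
  obtain ⟨y₀, hy₀⟩ := flatTorus_proj_surjective L' (ψ (flatTorus.proj L 0))
  obtain ⟨F, hFc, hF0, hF⟩ := exists_lift ψ.continuous hy₀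
  obtain ⟨G, hGc, hG0, hG⟩ := exists_lift (L := L') (L' := L) (x := y₀) (y := 0)
    ψ.symm.continuous (by rw [hy₀, ψ.symm_apply_apply])
  -- Both sides lift the same projection and agree at one point, so they coincide by uniqueness of
  -- lifts.
  have hGF : G ∘ F = id := (isCoveringMap_flatTorus_proj L).eq_of_comp_eq (hGc.comp hFc)
    continuous_id (funext fun z => by simp [hG, hF]) 0 (by simp [hF0, hG0])
  have hFG : F ∘ G = id := (isCoveringMap_flatTorus_proj L').eq_of_comp_eq (hFc.comp hGc)
    continuous_id (funext fun z => by simp [hG, hF]) y₀ (by simp [hF0, hG0])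
  have hFl := lipschitzWith_one_lift ψ.contMDiff hψ hFc hF
  have hGl := lipschitzWith_one_lift ψ.symm.contMDiff hψs hGc hG
  -- `F` and its inverse `G` are both 1-Lipschitz, so `F` preserves distances.
  have hFi : Isometry F := Isometry.of_dist_eq fun a b => by
    refine le_antisymm (by simpa using hFl.dist_le_mul a b) ?_
    have h := hGl.dist_le_mul (F a) (F b)
    rw [show G (F a) = a from congrFun hGF a, show G (F b) = b from congrFun hGF b] at h
    simpa using h
  let e : EuclideanSpace ℝ (Fin n) ≃ᵢ EuclideanSpace ℝ (Fin n) :=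
    ⟨⟨F, G, congrFun hGF, congrFun hFG⟩, hFi⟩
  -- By the Mazur–Ulam theorem the bijective isometry is affine. Since `F l` and `F 0` lie over the
  -- same point, the linear part maps `l` into `L'`.
  refine ⟨e.toRealAffineIsometryEquiv.linearIsometryEquiv, fun l hl => ?_⟩
  have h1 := e.toRealAffineIsometryEquiv.map_vadd 0 l
  simp only [vadd_eq_add, add_zero] at h1
  have h2 : flatTorus.proj L' (F 0) = flatTorus.proj L' (F l) := by
    rw [hF, hF, (flatTorus_proj_eq_iff L).2 (show l - 0 ∈ L by simpa using hl)]
  have h3 := (flatTorus_proj_eq_iff L').1 h2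
  have h4 : F l = e.toRealAffineIsometryEquiv.linearIsometryEquiv l + F 0 := h1
  rwa [h4, add_sub_cancel_right] at h3

end Lift

/-! ### Diffeomorphisms induced by linear maps -/

section LinearMaps

open MeasureTheory

variable {n : ℕ} {L L' : Submodule ℤ (EuclideanSpace ℝ (Fin n))} [DiscreteTopology L]
  [IsZLattice ℝ L] [DiscreteTopology L'] [IsZLattice ℝ L']

variable (L L') in
/-- The map of flat tori induced by a linear map. -/
def torusMap (A : EuclideanSpace ℝ (Fin n) →L[ℝ] EuclideanSpace ℝ (Fin n)) (p : flatTorus L) :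
    flatTorus L' :=
  flatTorus.proj L' (A (Function.surjInv (flatTorus_proj_surjective L) p))

theorem torusMap_proj {A : EuclideanSpace ℝ (Fin n) →L[ℝ] EuclideanSpace ℝ (Fin n)}
    (hA : ∀ l ∈ L, A l ∈ L') (x : EuclideanSpace ℝ (Fin n)) :
    torusMap L L' A (flatTorus.proj L x) = flatTorus.proj L' (A x) := by
  refine (flatTorus_proj_eq_iff L').2 ?_
  rw [← map_sub]
  exact hA _ ((flatTorus_proj_eq_iff L).1
    (Function.surjInv_eq (flatTorus_proj_surjective L) (flatTorus.proj L x)))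

theorem contMDiff_torusMap {A : EuclideanSpace ℝ (Fin n) →L[ℝ] EuclideanSpace ℝ (Fin n)}
    (hA : ∀ l ∈ L, A l ∈ L') : ContMDiff (𝓡 n) (𝓡 n) ∞ (torusMap L L' A) := by
  refine contMDiff_of_contMDiff_comp_proj L ?_
  simp only [torusMap_proj hA]
  exact (contMDiff_flatTorus_proj L').comp A.contDiff.contMDiff

/-- The diffeomorphism of flat tori induced by a linear isomorphism that maps one lattice onto the
other one. -/
def torusDiffeomorph (A : EuclideanSpace ℝ (Fin n) ≃L[ℝ] EuclideanSpace ℝ (Fin n))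
    (hA : ∀ l ∈ L, A l ∈ L') (hA' : ∀ l ∈ L', A.symm l ∈ L) :
    flatTorus L ≃ₘ⟮𝓡 n, 𝓡 n⟯ flatTorus L' where
  toFun := torusMap L L' A
  invFun := torusMap L' L A.symm
  left_inv p := by
    obtain ⟨x, rfl⟩ := flatTorus_proj_surjective L p
    rw [torusMap_proj (A := (A : EuclideanSpace ℝ (Fin n) →L[ℝ] EuclideanSpace ℝ (Fin n))) hA,
      torusMap_proj (A := (A.symm : EuclideanSpace ℝ (Fin n) →L[ℝ] EuclideanSpace ℝ (Fin n))) hA']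
    simp
  right_inv p := by
    obtain ⟨x, rfl⟩ := flatTorus_proj_surjective L' p
    rw [torusMap_proj (A := (A.symm : EuclideanSpace ℝ (Fin n) →L[ℝ] EuclideanSpace ℝ (Fin n))) hA',
      torusMap_proj (A := (A : EuclideanSpace ℝ (Fin n) →L[ℝ] EuclideanSpace ℝ (Fin n))) hA]
    simp
  contMDiff_toFun := contMDiff_torusMap hA
  contMDiff_invFun := contMDiff_torusMap hA'

theorem torusDiffeomorph_proj (A : EuclideanSpace ℝ (Fin n) ≃L[ℝ] EuclideanSpace ℝ (Fin n))
    (hA : ∀ l ∈ L, A l ∈ L') (hA' : ∀ l ∈ L', A.symm l ∈ L) (x : EuclideanSpace ℝ (Fin n)) :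
    torusDiffeomorph A hA hA' (flatTorus.proj L x) = flatTorus.proj L' (A x) :=
  torusMap_proj (A := (A : EuclideanSpace ℝ (Fin n) →L[ℝ] EuclideanSpace ℝ (Fin n))) hA x

/-- A linear isomorphism of determinant one preserves integrals. -/
theorem integral_comp_torusDiffeomorph
    (A : EuclideanSpace ℝ (Fin n) ≃L[ℝ] EuclideanSpace ℝ (Fin n))
    (hA : ∀ l ∈ L, A l ∈ L') (hA' : ∀ l ∈ L', A.symm l ∈ L)
    (hdet : LinearMap.det (A : EuclideanSpace ℝ (Fin n) →ₗ[ℝ] EuclideanSpace ℝ (Fin n)) = 1)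
    {a : flatTorus L' → ℝ} (ha : Continuous a) :
    ∫ x, a (torusDiffeomorph A hA hA' x) ∂(flatTorus L).vol = ∫ y, a y ∂(flatTorus L').vol := by
  obtain ⟨F, hF, -⟩ := exists_isBounded_isAddFundamentalDomain L
  have hmp : MeasurePreserving A (volume : Measure (EuclideanSpace ℝ (Fin n))) volume := by
    refine ⟨A.continuous.measurable, ?_⟩
    have h := Measure.map_linearMap_addHaar_eq_smul_addHaar
      (volume : Measure (EuclideanSpace ℝ (Fin n)))
      (f := (A : EuclideanSpace ℝ (Fin n) →ₗ[ℝ] EuclideanSpace ℝ (Fin n))) (by simp [hdet])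
    rw [hdet] at h
    simpa using h
  have hmp' : MeasurePreserving A.symm (volume : Measure (EuclideanSpace ℝ (Fin n))) volume :=
    hmp.symm A.toHomeomorph.toMeasurableEquiv
  let e : L' ≃ L :=
    { toFun l := ⟨A.symm l, hA' l l.2⟩
      invFun l := ⟨A l, hA l l.2⟩
      left_inv l := by simp
      right_inv l := by simp }
  -- `A` intertwines the translation actions of the two lattices, so it carries fundamental domains
  -- to fundamental domains.
  have hF' : IsAddFundamentalDomain L' (A '' F) volume :=
    hF.image_of_equiv A.toEquiv hmp'.quasiMeasurePreserving e fun g x => by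
      simp [e, Submodule.vadd_def]
  rw [integral_flatTorus L' hF' ha, integral_flatTorus L hF
    (g := fun x => a (torusDiffeomorph A hA hA' x)) (ha.comp (torusDiffeomorph A hA hA').continuous),
    hmp.setIntegral_image_emb A.toHomeomorph.measurableEmbedding]
  simp only [torusDiffeomorph_proj]

/-- A volume-preserving linear isomorphism between isospectral flat tori preserves the zeta
functions. -/
theorem zetaPreserving_torusDiffeomorph (hn : 0 < n)
    (A : EuclideanSpace ℝ (Fin n) ≃L[ℝ] EuclideanSpace ℝ (Fin n))
    (hA : ∀ l ∈ L, A l ∈ L') (hA' : ∀ l ∈ L', A.symm l ∈ L)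
    (hdet : LinearMap.det (A : EuclideanSpace ℝ (Fin n) →ₗ[ℝ] EuclideanSpace ℝ (Fin n)) = 1)
    (T : dualLattice L ≃ dualLattice L') (hT : ∀ k, ‖(T k : EuclideanSpace ℝ (Fin n))‖ ^ 2 =
      ‖(k : EuclideanSpace ℝ (Fin n))‖ ^ 2) :
    ClosedRiemannianManifold.ZetaPreserving (torusDiffeomorph A hA hA') := by
  intro BX BY a ha
  have hφ : Continuous (a ∘ torusDiffeomorph A hA hA') :=
    ha.continuous.comp (torusDiffeomorph A hA hA').continuous
  have hX := fun (s : ℂ) (hs : (n : ℝ) / 2 < s.re) => summable_zetaTerm_and_tsum_eq hn BX hφ hs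
  have hY := fun (s : ℂ) (hs : (n : ℝ) / 2 < s.re) =>
    summable_zetaTerm_and_tsum_eq hn BY ha.continuous hs
  refine ⟨fun s hs => ⟨(hY s hs).1, (hX s hs).1⟩, ?_⟩
  refine ClosedRiemannianManifold.meromorphicExtension_congr fun s hs => ?_
  have hvol : (flatTorus L').vol.real Set.univ = (flatTorus L).vol.real Set.univ := by
    have h := integral_comp_torusDiffeomorph A hA hA' hdet (a := fun _ => 1) continuous_const
    simpa using h.symm
  rw [(hY s hs).2, (hX s hs).2, ← T.tsum_eq, hvol]
  simp only [hT, Function.comp_apply, integral_comp_torusDiffeomorph A hA hA' hdet ha.continuous]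

theorem isospectral_of_equiv (hn : 0 < n) (T : dualLattice L ≃ dualLattice L')
    (hT : ∀ k, ‖(T k : EuclideanSpace ℝ (Fin n))‖ ^ 2 = ‖(k : EuclideanSpace ℝ (Fin n))‖ ^ 2) :
    (flatTorus L).Isospectral (flatTorus L') := by
  intro BX BY
  obtain ⟨τ, hτ⟩ := exists_equiv_eigenvalue_eq hn BX
  obtain ⟨τ', hτ'⟩ := exists_equiv_eigenvalue_eq hn BY
  refine ⟨(τ.trans T).trans τ'.symm, fun k => ?_⟩
  rw [hτ', hτ]
  simp [hT]

end LinearMaps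

end FlatTorus

/-! ### The two lattices in integer coordinates -/

/-- The integer matrix `H` with `G = (2√3)⁻¹ diag(1, √7, √13, √19) H`. -/
def tetraMatrix (e : ℤ) : Matrix (Fin 4) (Fin 4) ℤ :=
  !![3 * e, 1, 1, 1; -1, 3 * e, -1, 1; -1, 1, 3 * e, -1; -1, -1, 1, 3 * e]

/-- The weights `1, 7, 13, 19`. -/
def tetraWeight : Fin 4 → ℤ := ![1, 7, 13, 19]

theorem tetraWeight_pos (i : Fin 4) : 0 < tetraWeight i := by
  fin_cases i <;> simp [tetraWeight]

theorem tetraWeight_cast_pos (i : Fin 4) : (0 : ℝ) < tetraWeight i :=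
  Int.cast_pos.2 (tetraWeight_pos i)

theorem tetraMatrix_mulVec (e : ℤ) (m : Fin 4 → ℤ) : (tetraMatrix e).mulVec m =
    ![3 * e * m 0 + m 1 + m 2 + m 3, -m 0 + 3 * e * m 1 - m 2 + m 3,
      -m 0 + m 1 + 3 * e * m 2 - m 3, -m 0 - m 1 + m 2 + 3 * e * m 3] := by
  ext i
  fin_cases i <;> simp [tetraMatrix, Matrix.mulVec, dotProduct, Fin.sum_univ_four] <;> ring

theorem generatorMatrix_apply (e : ℤ) (i j : Fin 4) :
    generatorMatrix e i j = 1 / (2 * √3) * √(tetraWeight i : ℝ) * (tetraMatrix e i j : ℝ) := by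
  fin_cases i <;> fin_cases j <;> simp [generatorMatrix, tetraWeight, tetraMatrix] <;> ring

/-! ### The tori are not isometric -/

section Isometric

/-- The inner product of two vectors of the lattice spanned by the columns of `G`. -/
theorem inner_columnVector_sum (e : ℤ) (m m' : Fin 4 → ℤ) :
    inner ℝ (∑ j, m j • columnVector (generatorMatrix e) j)
      (∑ j, m' j • columnVector (generatorMatrix e) j) =
    (1 / 12 : ℝ) * (∑ i, tetraWeight i *
      ((tetraMatrix e).mulVec m i * (tetraMatrix e).mulVec m' i) : ℤ) := by
  have hv : ∀ (m : Fin 4 → ℤ) (i : Fin 4), (∑ j, m j • columnVector (generatorMatrix e) j) i =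
      1 / (2 * √3) * √(tetraWeight i : ℝ) * ((tetraMatrix e).mulVec m i : ℝ) := fun m i => by
    simp only [columnVector, Matrix.mulVec, dotProduct, WithLp.ofLp_sum, Finset.sum_apply,
      PiLp.smul_apply, generatorMatrix_apply, zsmul_eq_mul]
    push_cast
    rw [Finset.mul_sum]
    exact Finset.sum_congr rfl fun j _ => by ring
  rw [PiLp.inner_apply, Int.cast_sum, Finset.mul_sum]
  refine Finset.sum_congr rfl fun i _ => ?_
  rw [hv, hv]
  have h3 : √3 ^ 2 = 3 := Real.sq_sqrt (by norm_num)
  have hi : √(tetraWeight i : ℝ) ^ 2 = tetraWeight i := Real.sq_sqrt (tetraWeight_cast_pos i).le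
  simp only [RCLike.inner_apply, conj_trivial]
  push_cast
  calc _ = √(tetraWeight i : ℝ) ^ 2 / (4 * √3 ^ 2) *
        (((tetraMatrix e).mulVec m i : ℝ) * ((tetraMatrix e).mulVec m' i : ℝ)) := by ring
    _ = _ := by
      rw [h3, hi]
      ring

theorem mem_columnLattice_iff {n : ℕ} {G : Matrix (Fin n) (Fin n) ℝ}
    {x : EuclideanSpace ℝ (Fin n)} :
    x ∈ columnLattice G ↔ ∃ m : Fin n → ℤ, ∑ j, m j • columnVector G j = x :=
  Submodule.mem_span_range_iff_exists_fun ℤ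

/-- As `Hᵀ H = 12`, the divisibilities say that `(a, b, c, d)` lies in the column span of `H₊`; the
value 48 means squared norm 4 in `Λ₊`. Positivity of the form bounds the coordinates and leaves a
finite check. -/
theorem short_vectors {a b c d : ℤ} (h : a ^ 2 + 7 * b ^ 2 + 13 * c ^ 2 + 19 * d ^ 2 = 48)
    (h1 : 12 ∣ 3 * a - b - c - d) (h2 : 12 ∣ a + 3 * b + c - d) (h3 : 12 ∣ a - b + 3 * c + d)
    (h4 : 12 ∣ a + b - c + 3 * d) :
    a = 3 ∧ b = -1 ∧ c = -1 ∧ d = -1 ∨ a = -3 ∧ b = 1 ∧ c = 1 ∧ d = 1 := by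
  have hd : d ∈ Finset.Icc (-1 : ℤ) 1 := Finset.mem_Icc.2 ⟨by nlinarith, by nlinarith⟩
  have hc : c ∈ Finset.Icc (-1 : ℤ) 1 := Finset.mem_Icc.2 ⟨by nlinarith, by nlinarith⟩
  have hb : b ∈ Finset.Icc (-2 : ℤ) 2 := Finset.mem_Icc.2 ⟨by nlinarith, by nlinarith⟩
  have ha : a ∈ Finset.Icc (-6 : ℤ) 6 := Finset.mem_Icc.2 ⟨by nlinarith, by nlinarith⟩
  have key : ∀ d ∈ Finset.Icc (-1 : ℤ) 1, ∀ c ∈ Finset.Icc (-1 : ℤ) 1,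
      ∀ b ∈ Finset.Icc (-2 : ℤ) 2, ∀ a ∈ Finset.Icc (-6 : ℤ) 6,
      a ^ 2 + 7 * b ^ 2 + 13 * c ^ 2 + 19 * d ^ 2 = 48 → 12 ∣ 3 * a - b - c - d →
      12 ∣ a + 3 * b + c - d → 12 ∣ a - b + 3 * c + d → 12 ∣ a + b - c + 3 * d →
      a = 3 ∧ b = -1 ∧ c = -1 ∧ d = -1 ∨ a = -3 ∧ b = 1 ∧ c = 1 ∧ d = 1 := by
    decide +kernel
  exact key d hd c hc b hb a ha h h1 h2 h3 h4

/-- Here 96 means squared norm 8, and the linear form is the weighted product with the short vector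
`(3, -1, -1, -1)`, so ±24 would be an inner product ±2. -/
theorem second_vectors {a b c d : ℤ} (h : a ^ 2 + 7 * b ^ 2 + 13 * c ^ 2 + 19 * d ^ 2 = 96)
    (h1 : 12 ∣ 3 * a - b - c - d) (h2 : 12 ∣ a + 3 * b + c - d) (h3 : 12 ∣ a - b + 3 * c + d)
    (h4 : 12 ∣ a + b - c + 3 * d) : 3 * a - 7 * b - 13 * c - 19 * d ≠ 24 ∧
      3 * a - 7 * b - 13 * c - 19 * d ≠ -24 := by
  have hd : d ∈ Finset.Icc (-2 : ℤ) 2 := Finset.mem_Icc.2 ⟨by nlinarith, by nlinarith⟩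
  have hc : c ∈ Finset.Icc (-2 : ℤ) 2 := Finset.mem_Icc.2 ⟨by nlinarith, by nlinarith⟩
  have hb : b ∈ Finset.Icc (-3 : ℤ) 3 := Finset.mem_Icc.2 ⟨by nlinarith, by nlinarith⟩
  have ha : a ∈ Finset.Icc (-9 : ℤ) 9 := Finset.mem_Icc.2 ⟨by nlinarith, by nlinarith⟩
  have key : ∀ d ∈ Finset.Icc (-2 : ℤ) 2, ∀ c ∈ Finset.Icc (-2 : ℤ) 2,
      ∀ b ∈ Finset.Icc (-3 : ℤ) 3, ∀ a ∈ Finset.Icc (-9 : ℤ) 9,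
      a ^ 2 + 7 * b ^ 2 + 13 * c ^ 2 + 19 * d ^ 2 = 96 → 12 ∣ 3 * a - b - c - d →
      12 ∣ a + 3 * b + c - d → 12 ∣ a - b + 3 * c + d → 12 ∣ a + b - c + 3 * d →
      3 * a - 7 * b - 13 * c - 19 * d ≠ 24 ∧ 3 * a - 7 * b - 13 * c - 19 * d ≠ -24 := by
    decide +kernel
  exact key d hd c hc b hb a ha h h1 h2 h3 h4

theorem not_isometric_torusMinus_torusPlus : ¬ torusMinus.Isometric torusPlus := by
  intro h
  obtain ⟨U, hU⟩ := FlatTorus.exists_linearIsometryEquiv_of_isometric h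
  have hmem : ∀ m : Fin 4 → ℤ,
      ∑ j, m j • columnVector (generatorMatrix (-1)) j ∈ latticeMinus := fun m =>
    mem_columnLattice_iff.2 ⟨m, rfl⟩
  have hplus : ∀ m : Fin 4 → ℤ, ∃ m' : Fin 4 → ℤ, ∑ j, m' j • columnVector (generatorMatrix 1) j =
      U (∑ j, m j • columnVector (generatorMatrix (-1)) j) := fun m =>
    mem_columnLattice_iff.1 (hU _ (hmem m))
  have hQ : ∀ m₁ m₂ m₁' m₂' : Fin 4 → ℤ,
      ∑ j, m₁' j • columnVector (generatorMatrix 1) j =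
        U (∑ j, m₁ j • columnVector (generatorMatrix (-1)) j) →
      ∑ j, m₂' j • columnVector (generatorMatrix 1) j =
        U (∑ j, m₂ j • columnVector (generatorMatrix (-1)) j) →
      ∑ i, tetraWeight i * ((tetraMatrix 1).mulVec m₁' i * (tetraMatrix 1).mulVec m₂' i) =
      ∑ i, tetraWeight i *
        ((tetraMatrix (-1)).mulVec m₁ i * (tetraMatrix (-1)).mulVec m₂ i) := by
    intro m₁ m₂ m₁' m₂' e1 e2
    have h1 := inner_columnVector_sum 1 m₁' m₂'
    have h2 := inner_columnVector_sum (-1) m₁ m₂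
    rw [Int.cast_one, e1, e2, U.inner_map_map] at h1
    rw [Int.cast_neg, Int.cast_one, h1] at h2
    exact_mod_cast mul_left_cancel₀ (by norm_num) h2
  -- In integer coordinates the first two columns of `G₋` are `(-3, -1, -1, -1)` and `(1, -3, 1,
  -- -1)`, with weighted squares 48 and 96 and weighted product 24.
  obtain ⟨x, hx⟩ := hplus ![1, 0, 0, 0]
  obtain ⟨y, hy⟩ := hplus ![0, 1, 0, 0]
  have hxx := hQ _ _ _ _ hx hx
  have hyy := hQ _ _ _ _ hy hy
  have hxy := hQ _ _ _ _ hx hy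
  simp only [tetraMatrix_mulVec, Fin.sum_univ_four, tetraWeight, Matrix.cons_val] at hxx hyy hxy
  have hx' := short_vectors (a := 3 * x 0 + x 1 + x 2 + x 3) (b := -x 0 + 3 * x 1 - x 2 + x 3)
    (c := -x 0 + x 1 + 3 * x 2 - x 3) (d := -x 0 - x 1 + x 2 + 3 * x 3) (by linarith)
    ⟨x 0, by ring⟩ ⟨x 1, by ring⟩ ⟨x 2, by ring⟩ ⟨x 3, by ring⟩
  have hy' := second_vectors (a := 3 * y 0 + y 1 + y 2 + y 3) (b := -y 0 + 3 * y 1 - y 2 + y 3)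
    (c := -y 0 + y 1 + 3 * y 2 - y 3) (d := -y 0 - y 1 + y 2 + 3 * y 3) (by linarith)
    ⟨y 0, by ring⟩ ⟨y 1, by ring⟩ ⟨y 2, by ring⟩ ⟨y 3, by ring⟩
  rcases hx' with ⟨h0, h1, h2, h3⟩ | ⟨h0, h1, h2, h3⟩
  · refine hy'.1 ?_
    linear_combination hxy - (3 * y 0 + y 1 + y 2 + y 3) * h0 -
      7 * (-y 0 + 3 * y 1 - y 2 + y 3) * h1 - 13 * (-y 0 + y 1 + 3 * y 2 - y 3) * h2 -
      19 * (-y 0 - y 1 + y 2 + 3 * y 3) * h3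
  · refine hy'.2 ?_
    linear_combination -hxy + (3 * y 0 + y 1 + y 2 + y 3) * h0 +
      7 * (-y 0 + 3 * y 1 - y 2 + y 3) * h1 + 13 * (-y 0 + y 1 + 3 * y 2 - y 3) * h2 +
      19 * (-y 0 - y 1 + y 2 + 3 * y 3) * h3

end Isometric

/-! ### The tori are isospectral -/

section Isospectral

/-- The integer vectors in the column span of `H`. -/
def tetraSet (e : ℤ) : Set (Fin 4 → ℤ) := Set.range (tetraMatrix e).mulVec

/-- Change the sign of the first coordinate divisible by `3` if the coordinates are odd. -/
def tetraFlip (x : Fin 4 → ℤ) : Fin 4 → ℤ :=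
  if x 0 % 2 = 0 then x
  else if x 0 % 3 = 0 then ![-x 0, x 1, x 2, x 3]
  else if x 1 % 3 = 0 then ![x 0, -x 1, x 2, x 3]
  else if x 2 % 3 = 0 then ![x 0, x 1, -x 2, x 3]
  else ![x 0, x 1, x 2, -x 3]

theorem tetraFlip_vec (a b c d : ℤ) : tetraFlip ![a, b, c, d] =
    if a % 2 = 0 then ![a, b, c, d]
    else if a % 3 = 0 then ![-a, b, c, d]
    else if b % 3 = 0 then ![a, -b, c, d]
    else if c % 3 = 0 then ![a, b, -c, d]
    else ![a, b, c, -d] := rfl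

/-- Sign changes preserve parity and divisibility by 3, so the second application takes the same
branch. -/
theorem tetraFlip_involutive : Function.Involutive tetraFlip := by
  intro x
  have hx : x = ![x 0, x 1, x 2, x 3] := by ext i; fin_cases i <;> rfl
  rw [hx]
  generalize x 0 = a
  generalize x 1 = b
  generalize x 2 = c
  generalize x 3 = d
  rw [tetraFlip_vec]
  split_ifs <;> simp_all [tetraFlip_vec]

theorem tetraFlip_sq (x : Fin 4 → ℤ) (i : Fin 4) : tetraFlip x i ^ 2 = x i ^ 2 := by
  unfold tetraFlip
  split_ifs <;> fin_cases i <;> simp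

/-- Modulo 3 the span of `H` is the tetracode, whose nonzero words have exactly one zero. Here `b ≡
c` would give `a ≡ 0`, so `c ≡ -b` and `d ≡ 0`. -/
theorem emod_three_eq_zero_of_dvd {a b c d : ℤ} (h₁ : 3 ∣ a + b - c) (h₂ : 3 ∣ b + c + d)
    (ha : ¬a % 3 = 0) (hb : ¬b % 3 = 0) (hc : ¬c % 3 = 0) : d % 3 = 0 := by
  have hb' : b % 3 = 1 ∨ b % 3 = 2 := by omega
  have hc' : c % 3 = 1 ∨ c % 3 = 2 := by omega
  rcases hb' with hb' | hb' <;> rcases hc' with hc' | hc' <;> omega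

/-- All entries of `H` are odd, so the coordinates of `x` share one parity. Replacing `e` by `-e`
changes `Hᵀ x` by `-6e x`. For even `x` this is 0 modulo 12. For odd `x` every entry of it is 6
modulo 12, and negating a coordinate that is an odd multiple of 3 changes every entry by 6 modulo 12
once more. -/
theorem tetraFlip_mem {e : ℤ} (he : e = 1 ∨ e = -1) {x : Fin 4 → ℤ} (hx : x ∈ tetraSet e) :
    tetraFlip x ∈ tetraSet (-e) := by
  obtain ⟨m, rfl⟩ := hx
  rw [tetraMatrix_mulVec]
  -- Membership in the column span of `H` amounts to `Hᵀ x ≡ 0` modulo 12, since `H Hᵀ = 12`.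
  have key : ∀ a b c d : ℤ, 12 ∣ 3 * -e * a - b - c - d → 12 ∣ a + 3 * -e * b + c - d →
      12 ∣ a - b + 3 * -e * c + d → 12 ∣ a + b - c + 3 * -e * d →
      ![a, b, c, d] ∈ tetraSet (-e) := by
    rintro a b c d ⟨p, hp⟩ ⟨q, hq⟩ ⟨r, hr⟩ ⟨s, hs⟩
    refine ⟨![p, q, r, s], ?_⟩
    rw [tetraMatrix_mulVec]
    rcases he with rfl | rfl
    all_goals
      ext i
      fin_cases i <;> simp <;> omega
  rw [tetraFlip_vec]
  generalize m 0 = p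
  generalize m 1 = q
  generalize m 2 = r
  generalize m 3 = s
  have hmod := @emod_three_eq_zero_of_dvd (3 * e * p + q + r + s) (-p + 3 * e * q - r + s)
    (-p + q + 3 * e * r - s) (-p - q + r + 3 * e * s) (by rcases he with rfl | rfl <;> omega)
    (by rcases he with rfl | rfl <;> omega)
  split_ifs with h0 h1 h2 h3
  -- The last branch tests nothing; the tetracode property shows that the remaining coordinate is
  -- divisible by 3.
  on_goal 5 => have h5 := hmod h1 h2 h3
  all_goals
    clear hmod
    refine key _ _ _ _ ?_ ?_ ?_ ?_
    all_goals rcases he with rfl | rfl <;> omega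

/-- The scaling of the coordinates that maps the integer column span of `H` onto the dual lattice. -/
def tetraEmbedding (x : Fin 4 → ℤ) : EuclideanSpace ℝ (Fin 4) :=
  WithLp.toLp 2 fun i => x i / (2 * √3 * √(tetraWeight i : ℝ))

theorem tetraEmbedding_injective : Function.Injective tetraEmbedding := by
  intro x y h
  ext i
  have h1 : (x i : ℝ) / (2 * √3 * √(tetraWeight i : ℝ)) =
      y i / (2 * √3 * √(tetraWeight i : ℝ)) := congrArg (fun v : EuclideanSpace ℝ (Fin 4) => v i) h
  have h2 : 2 * √3 * √(tetraWeight i : ℝ) ≠ 0 := by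
    have := tetraWeight_cast_pos i
    positivity
  exact_mod_cast (div_left_inj' h2).1 h1

theorem norm_tetraEmbedding_tetraFlip (x : Fin 4 → ℤ) :
    ‖tetraEmbedding (tetraFlip x)‖ ^ 2 = ‖tetraEmbedding x‖ ^ 2 := by
  simp only [EuclideanSpace.real_norm_sq_eq]
  refine Finset.sum_congr rfl fun i _ => ?_
  simp only [tetraEmbedding, div_pow]
  congr 1
  exact_mod_cast tetraFlip_sq x i

theorem inner_columnVector (e : ℤ) (k : EuclideanSpace ℝ (Fin 4)) (j : Fin 4) :
    inner ℝ k (columnVector (generatorMatrix e) j) =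
      ∑ i, 1 / (2 * √3) * √(tetraWeight i : ℝ) * (tetraMatrix e i j : ℝ) * k i := by
  rw [PiLp.inner_apply]
  refine Finset.sum_congr rfl fun i _ => ?_
  simp [columnVector, generatorMatrix_apply]

theorem tetraMatrix_mul_transpose {e : ℤ} (he : e = 1 ∨ e = -1) :
    tetraMatrix e * (tetraMatrix e).transpose = 12 := by
  rcases he with rfl | rfl <;> decide

theorem mem_dualLattice_iff {n : ℕ} {G : Matrix (Fin n) (Fin n) ℝ}
    {k : EuclideanSpace ℝ (Fin n)} : k ∈ FlatTorus.dualLattice (columnLattice G) ↔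
      ∀ j, ∃ z : ℤ, (z : ℝ) = inner ℝ k (columnVector G j) := by
  rw [FlatTorus.mem_dualLattice]
  refine ⟨fun h j => h _ (Submodule.subset_span ⟨j, rfl⟩), fun h l hl => ?_⟩
  obtain ⟨m, rfl⟩ := mem_columnLattice_iff.1 hl
  choose z hz using h
  refine ⟨∑ j, m j * z j, ?_⟩
  rw [inner_sum]
  push_cast
  refine Finset.sum_congr rfl fun j _ => ?_
  rw [hz, ← Int.cast_smul_eq_zsmul ℝ, inner_smul_right]

/-- The dual lattice is spanned by the columns of the inverse transpose of `G = (2√3)⁻¹ D H`.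
Because `H Hᵀ = 12 = (2√3)²`, this matrix is `(2√3)⁻¹ D⁻¹ H`, with the same `H`. -/
theorem dualLattice_generatorMatrix {e : ℤ} (he : e = 1 ∨ e = -1) :
    (FlatTorus.dualLattice (columnLattice (generatorMatrix e)) : Set (EuclideanSpace ℝ (Fin 4))) =
      tetraEmbedding '' tetraSet e := by
  have h3 : √3 ^ 2 = 3 := Real.sq_sqrt (by norm_num)
  have hw : ∀ i, √(tetraWeight i : ℝ) ≠ 0 := fun i => (Real.sqrt_pos.2 (tetraWeight_cast_pos i)).ne'
  have hH : tetraMatrix e * (tetraMatrix e).transpose = 12 := tetraMatrix_mul_transpose he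
  have hH' : (tetraMatrix e).transpose * tetraMatrix e = 12 := by
    rcases he with rfl | rfl <;> decide
  ext k
  rw [SetLike.mem_coe, mem_dualLattice_iff]
  constructor
  · intro h
    choose z hz using h
    refine ⟨(tetraMatrix e).mulVec z, ⟨z, rfl⟩, ?_⟩
    ext i
    have h1 : ((tetraMatrix e).mulVec z i : ℝ) = 12 * (1 / (2 * √3) * √(tetraWeight i : ℝ) * k i) := by
      simp only [Matrix.mulVec, dotProduct]
      push_cast
      simp only [hz, inner_columnVector, Finset.mul_sum]
      rw [Finset.sum_comm]
      have h2 : ∀ l, ∑ j, (tetraMatrix e i j : ℝ) *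
          (1 / (2 * √3) * √(tetraWeight l : ℝ) * (tetraMatrix e l j : ℝ) * k l) =
          (1 / (2 * √3) * √(tetraWeight l : ℝ) * k l) *
            ((tetraMatrix e * (tetraMatrix e).transpose) i l : ℤ) := fun l => by
        rw [Matrix.mul_apply]
        push_cast
        rw [Finset.mul_sum]
        exact Finset.sum_congr rfl fun j _ => by rw [Matrix.transpose_apply]; ring
      simp only [h2, hH]
      rw [Finset.sum_eq_single i]
      · simp [Matrix.ofNat_apply]
        ring
      · intro l _ hl
        simp [Matrix.ofNat_apply, hl.symm]
      · simp
    simp only [tetraEmbedding]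
    rw [h1]
    have := hw i
    field_simp
    rw [h3]
    norm_num
  · rintro ⟨_, ⟨z, rfl⟩, rfl⟩ j
    refine ⟨z j, ?_⟩
    rw [inner_columnVector]
    have h1 : ∀ i, 1 / (2 * √3) * √(tetraWeight i : ℝ) * (tetraMatrix e i j : ℝ) *
        tetraEmbedding ((tetraMatrix e).mulVec z) i =
        1 / 12 * ((tetraMatrix e).transpose j i * (tetraMatrix e).mulVec z i : ℤ) := fun i => by
      have := hw i
      simp only [tetraEmbedding, Matrix.transpose_apply]
      push_cast
      field_simp
      rw [h3]
      ring
    simp only [h1, ← Finset.mul_sum]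
    rw [← Int.cast_sum]
    have h2 : ∑ i, (tetraMatrix e).transpose j i * (tetraMatrix e).mulVec z i = 12 * z j := by
      change ((tetraMatrix e).transpose.mulVec ((tetraMatrix e).mulVec z)) j = _
      rw [Matrix.mulVec_mulVec, hH']
      simp [Matrix.ofNat_mulVec]
    rw [h2]
    push_cast
    ring

theorem exists_equiv_dualLattice : ∃ T : FlatTorus.dualLattice latticeMinus ≃
    FlatTorus.dualLattice latticePlus, ∀ k,
      ‖(T k : EuclideanSpace ℝ (Fin 4))‖ ^ 2 = ‖(k : EuclideanSpace ℝ (Fin 4))‖ ^ 2 := by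
  have hm : (FlatTorus.dualLattice latticeMinus : Set (EuclideanSpace ℝ (Fin 4))) =
      tetraEmbedding '' tetraSet (-1) := by
    simpa using dualLattice_generatorMatrix (e := -1) (Or.inr rfl)
  have hp : (FlatTorus.dualLattice latticePlus : Set (EuclideanSpace ℝ (Fin 4))) =
      tetraEmbedding '' tetraSet 1 := by
    simpa using dualLattice_generatorMatrix (e := 1) (Or.inl rfl)
  let t : tetraSet (-1) ≃ tetraSet 1 := tetraFlip_involutive.toPerm.subtypeEquiv fun x =>
    ⟨fun h => by simpa using tetraFlip_mem (Or.inr rfl) h, fun h => by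
      have h2 := tetraFlip_mem (Or.inl rfl) h
      rwa [Function.Involutive.coe_toPerm, tetraFlip_involutive] at h2⟩
  let em := (Equiv.Set.image tetraEmbedding (tetraSet (-1)) tetraEmbedding_injective).trans
    (Equiv.setCongr hm.symm)
  let ep := (Equiv.Set.image tetraEmbedding (tetraSet 1) tetraEmbedding_injective).trans
    (Equiv.setCongr hp.symm)
  refine ⟨(em.symm.trans t).trans ep, fun k => ?_⟩
  obtain ⟨x, rfl⟩ := em.surjective k
  have h1 : ((em.symm.trans t).trans ep (em x) : EuclideanSpace ℝ (Fin 4)) =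
      tetraEmbedding (tetraFlip x) := by
    change tetraEmbedding (t (em.symm (em x))) = _
    rw [em.symm_apply_apply]
    rfl
  rw [h1]
  exact norm_tetraEmbedding_tetraFlip x

end Isospectral

/-! ### The linear map `A` -/

section ChangeOfBasis

theorem det_generatorMatrix_one_eq : (generatorMatrix 1).det = (generatorMatrix (-1)).det := by
  rw [generatorMatrix, generatorMatrix, Matrix.det_smul, Matrix.det_smul]
  congr 1
  simp [Matrix.det_succ_row_zero, Fin.sum_univ_succ, Fin.succAbove]
  ring

theorem changeOfBasis_det : changeOfBasis.det = 1 := by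
  rw [changeOfBasis, Matrix.det_mul, Matrix.det_nonsing_inv, det_generatorMatrix_one_eq,
    Ring.inverse_eq_inv', mul_inv_cancel₀ (generatorMatrix_det_ne_zero _)]

theorem toEuclideanLin_mem_columnLattice {n : ℕ} {A G G' : Matrix (Fin n) (Fin n) ℝ}
    (h : A * G = G') {x : EuclideanSpace ℝ (Fin n)} (hx : x ∈ columnLattice G) :
    Matrix.toEuclideanLin A x ∈ columnLattice G' := by
  obtain ⟨m, rfl⟩ := mem_columnLattice_iff.1 hx
  refine mem_columnLattice_iff.2 ⟨m, ?_⟩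
  rw [map_sum]
  refine Finset.sum_congr rfl fun j _ => ?_
  rw [map_zsmul]
  congr 1
  ext i
  simp [columnVector, ← h, Matrix.mul_apply, Matrix.mulVec, dotProduct]

/-- The linear isomorphism `x ↦ A x`. -/
def changeOfBasisEquiv : EuclideanSpace ℝ (Fin 4) ≃L[ℝ] EuclideanSpace ℝ (Fin 4) :=
  (LinearEquiv.ofLinearMap (Matrix.toEuclideanLin changeOfBasis)
    (Matrix.toEuclideanLin changeOfBasis⁻¹)
    (by
      rw [← Matrix.toLpLin_mul_same, Matrix.mul_nonsing_inv _ (by simp [changeOfBasis_det]),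
        Matrix.toLpLin_one])
    (by
      rw [← Matrix.toLpLin_mul_same, Matrix.nonsing_inv_mul _ (by simp [changeOfBasis_det]),
        Matrix.toLpLin_one])).toContinuousLinearEquiv

theorem changeOfBasisEquiv_mem {l : EuclideanSpace ℝ (Fin 4)} (hl : l ∈ latticeMinus) :
    changeOfBasisEquiv l ∈ latticePlus := by
  refine toEuclideanLin_mem_columnLattice ?_ hl
  rw [changeOfBasis, Matrix.mul_assoc, Matrix.nonsing_inv_mul _
    (isUnit_iff_ne_zero.2 (generatorMatrix_det_ne_zero _)), Matrix.mul_one]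

theorem changeOfBasisEquiv_symm_mem {l : EuclideanSpace ℝ (Fin 4)} (hl : l ∈ latticePlus) :
    changeOfBasisEquiv.symm l ∈ latticeMinus := by
  refine toEuclideanLin_mem_columnLattice (A := changeOfBasis⁻¹) ?_ hl
  rw [changeOfBasis, Matrix.mul_inv_rev, Matrix.nonsing_inv_nonsing_inv _
    (isUnit_iff_ne_zero.2 (generatorMatrix_det_ne_zero _)), Matrix.mul_assoc,
    Matrix.nonsing_inv_mul _ (isUnit_iff_ne_zero.2 (generatorMatrix_det_ne_zero _)),
    Matrix.mul_one]

theorem det_changeOfBasisEquiv : LinearMap.det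
    (changeOfBasisEquiv : EuclideanSpace ℝ (Fin 4) →ₗ[ℝ] EuclideanSpace ℝ (Fin 4)) = 1 := by
  change LinearMap.det (Matrix.toEuclideanLin changeOfBasis) = 1
  rw [LinearMap.det_toLpLin, changeOfBasis_det]

end ChangeOfBasis

end

theorem mainTheorem10 :
    Nonempty torusMinus.EigenBasis ∧ Nonempty torusPlus.EigenBasis ∧
    torusMinus.Isospectral torusPlus ∧
    ¬ torusMinus.Isometric torusPlus ∧
    changeOfBasis.det = 1 ∧
    ∃ φ : torusMinus ≃ₘ⟮𝓡 4, 𝓡 4⟯ torusPlus,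
      (∀ x : EuclideanSpace ℝ (Fin 4),
        φ (flatTorus.proj latticeMinus x) =
          flatTorus.proj latticePlus (Matrix.toEuclideanLin changeOfBasis x)) ∧
      ClosedRiemannianManifold.ZetaPreserving φ := by
  obtain ⟨e⟩ := FlatTorus.nonempty_equiv_dualLattice latticeMinus (by norm_num)
  obtain ⟨e'⟩ := FlatTorus.nonempty_equiv_dualLattice latticePlus (by norm_num)
  obtain ⟨T, hT⟩ := exists_equiv_dualLattice
  exact ⟨⟨FlatTorus.hartleyBasis _ e⟩, ⟨FlatTorus.hartleyBasis _ e'⟩,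
    FlatTorus.isospectral_of_equiv (by norm_num) T hT, not_isometric_torusMinus_torusPlus,
    changeOfBasis_det,
    FlatTorus.torusDiffeomorph changeOfBasisEquiv (fun _ => changeOfBasisEquiv_mem)
      fun _ => changeOfBasisEquiv_symm_mem,
    FlatTorus.torusDiffeomorph_proj _ _ _,
    FlatTorus.zetaPreserving_torusDiffeomorph (by norm_num) _ _ _ det_changeOfBasisEquiv T hT⟩
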